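/- **Model.** Let $G=(V,E)$ be a finite connected undirected graph with $n$ vertices, with an input bit $x_v\in\{0,1\}$ available only at the vertex $v$, and with a start vertex $s\in V$. A quantum robot on $G$ has a finite workspace $\{0,1\}^m$ ($m\ge 1$ arbitrary) and states $\sum_{v,z}\alpha_{v,z}|v,z\rangle$ with $v\in V$, $z\in\{0,1\}^m$; it starts in $|s,0\rangle$ and alternates $T$ algorithm steps with $T$ oracle steps $U^{(1)},O,U^{(2)},O,\dots,U^{(T)},O$. The oracle step $O$ maps $|v,z\rangle$ to $|v,z'\rangle$, where $z'$ is $z$ with $x_v$ exclusive-OR'ed into its first bit. Each $U^{(t)}$ is a unitary that does not depend on the input and is *C-local*: the basis states $|v,z\rangle$ can be partitioned into blocks such that $U^{(t)}$ has zero entries between distinct blocks, and such that the basis states in any one block all come from a single vertex or from two adjacent vertices. The robot evaluates $f:\{0,1\}^V\to\{0,1\}$ in $T$ steps if for every input $x$, a measurement after the $T$-th oracle step shows $f(x)$ in a designated output bit of $z$ with probability at least $2/3$. Let $Q(f,G)$ be the least such $T$ over all robots on $G$, and let $\mathrm{OR}(x)=1$ if and only if $x_v=1$ for some $v$. A family of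 finite connected graphs is *$d$-dimensional* ($d$ real) if there is $\kappa>0$ such that for every graph $G=(V,E)$ of the family, with $n=|V|$, every $v\in V$ and every integer $\ell\ge 0$, $$|B(v,\ell)|\ \ge\ \min(\kappa\,\ell^{d},\,n),$$ where $B(v,\ell)$ is the set of vertices at distance at most $\ell$ from $v$. **Theorem.** Let $\mathcal G$ be a $d$-dimensional family of graphs. (i) If $d>2$ is a constant, then $Q(\mathrm{OR},G)=O(\sqrt n\,\mathrm{polylog}\,n)$: there are constants $C$ and $k$, depending only on the family and on $d$, such that $Q(\mathrm{OR},G)\le C\sqrt n\,(\log n)^k$ for every $G\in\mathcal G$ with $n\ge 2$ vertices and every start vertex. (ii) If $d=2$, then $Q(\mathrm{OR},G)=\sqrt n\,2^{O(\sqrt{\log n})}$: there is a constant $C$, depending only on the family, such that $Q(\mathrm{OR},G)\le\sqrt n\,2^{C\sqrt{\log n}}$ for every $G\in\mathcal G$ with $n\ge 2$ vertices and every start vertex. -/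

import Mathlib

open scoped ENNReal

noncomputable section

/-- The computational basis `|v, z⟩` of a quantum robot on the vertex set `V`: a location `v`
together with an internal configuration `z`, a string of `b + 1` bits. -/
abbrev RobotBasis (V : Type*) (b : ℕ) : Type _ := V × (Fin (b + 1) → Bool)

/-- C-locality of a matrix with respect to `G`. The entry `U y x` (row `y`, column `x`) is the
amplitude sent from the basis state `x` to the basis state `y`. The partition of the basis states
is given by the classes of a setoid `P`. -/
def IsCLocal {V : Type*} {b : ℕ} (G : SimpleGraph V)
    (U : Matrix (RobotBasis V b) (RobotBasis V b) ℂ) : Prop :=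
  ∃ P : Setoid (RobotBasis V b),
    (∀ x y, ¬ P x y → U y x = 0) ∧
    ∀ x, ∃ v w : V, (v = w ∨ G.Adj v w) ∧ ∀ y, P x y → y.1 = v ∨ y.1 = w

/-- The action of the oracle on basis states, `|v, z⟩ ↦ |v, z ⊕ X v⟩`, where the input bit located
at `v` is exclusive-OR'ed into the first bit of `z`. -/
def queryBasis {V : Type*} {b : ℕ} (X : V → Bool) (x : RobotBasis V b) : RobotBasis V b :=
  (x.1, Function.update x.2 0 (xor (x.2 0) (X x.1)))

/-- The oracle step on input `X`, as a permutation matrix. -/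
def oracleMatrix {V : Type*} [DecidableEq V] (b : ℕ) (X : V → Bool) :
    Matrix (RobotBasis V b) (RobotBasis V b) ℂ :=
  Matrix.of fun y x => if y = queryBasis X x then 1 else 0

/-- A quantum robot on `G`: a workspace of `workBits + 1` bits, an output bit, and a sequence of
algorithm steps, each a C-local unitary independent of the input. A `T`-query run only uses the
steps `0, …, T - 1`. -/
structure QuantumRobot {V : Type*} [Fintype V] [DecidableEq V] (G : SimpleGraph V) where
  workBits : ℕ
  out : Fin (workBits + 1)
  step : ℕ → Matrix (RobotBasis V workBits) (RobotBasis V workBits) ℂ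
  step_unitary : ∀ t, step t ∈ Matrix.unitaryGroup (RobotBasis V workBits) ℂ
  step_local : ∀ t, IsCLocal G (step t)

namespace QuantumRobot

variable {V : Type*} [Fintype V] [DecidableEq V] {G : SimpleGraph V}

/-- The amplitudes immediately after the `t`-th oracle step on input `X`, starting from the basis
state `|s, 0⟩` and alternating algorithm steps and oracle steps. -/
def state (A : QuantumRobot G) (s : V) (X : V → Bool) : ℕ → RobotBasis V A.workBits → ℂ
  | 0 => Pi.single (s, fun _ => false) 1
  | t + 1 => (oracleMatrix A.workBits X).mulVec ((A.step t).mulVec (A.state s X t))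

/-- The probability that the output bit reads `c` after `T` steps on input `X`. -/
def outputProb (A : QuantumRobot G) (s : V) (X : V → Bool) (T : ℕ) (c : Bool) : ℝ :=
  ∑ x : RobotBasis V A.workBits with x.2 A.out = c, ‖A.state s X T x‖ ^ 2

/-- Started at `s`, the robot evaluates `f` in `T` steps with probability at least `2/3` on every
input. -/
def Evaluates (A : QuantumRobot G) (s : V) (f : (V → Bool) → Bool) (T : ℕ) : Prop :=
  ∀ X, 2 / 3 ≤ A.outputProb s X T (f X)

end QuantumRobot

/-- `Q(f, G)` with start vertex `s`: the least `T` such that some quantum robot on `G` evaluates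
`f` in `T` steps (and `⊤` if there is no such `T`). -/
def robotComplexity {V : Type*} [Fintype V] [DecidableEq V] (G : SimpleGraph V) (s : V)
    (f : (V → Bool) → Bool) : ℕ∞ :=
  ⨅ (T : ℕ) (_ : ∃ A : QuantumRobot G, A.Evaluates s f T), (T : ℕ∞)

/-- The function `OR` of the bits placed at the vertices. -/
def orFunction {V : Type*} [Fintype V] (X : V → Bool) : Bool :=
  decide (∃ v, X v = true)

/-- The set `B(v, ℓ)` of vertices at distance at most `ℓ` from `v`. -/
def graphBall {V : Type*} (G : SimpleGraph V) (v : V) (l : ℕ) : Set V :=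
  {w | G.edist v w ≤ l}

/-- A family of finite connected graphs is `d`-dimensional if, for one `κ > 0`, all balls satisfy
`|B(v, ℓ)| ≥ min (κ ℓ ^ d) n`, where `n` is the number of vertices of the graph. -/
def IsDimensionalFamily {ι : Type*} {V : ι → Type*} [∀ i, Fintype (V i)]
    (G : ∀ i, SimpleGraph (V i)) (d : ℝ) : Prop :=
  (∀ i, (G i).Connected) ∧
  ∃ κ : ℝ, 0 < κ ∧ ∀ (i : ι) (v : V i) (l : ℕ),
    min (κ * (l : ℝ) ^ d) (Fintype.card (V i) : ℝ) ≤ ((graphBall (G i) v l).ncard : ℝ)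

end

/-! The robot runs a quantum walk on an electric network. From every vertex of `G` a walk of a
common length leads to `s`, and walks that share a label stay together from then on. Unrolled in
time, the walks form a layered network with all vertices in layer `0` and only `s` in the last
layer. An edge leaving layer `k` has conductance `k + 1`, and one dangling arc at `s` is the start
state `e`.

Let `R` negate, at each node, the vector of square roots of the conductances, let `S` reverse arcs
with a sign, and let `Q` be the phase query at layer `0`; put `U = S Q R`. If `v` is marked, the
unit flow from `v` to `s` is fixed by `U`: Kirchhoff's law gives this away from the source, and `Q`
corrects the sign at the source. This flow has a large entry at `e`. If nothing is marked, the
vector `c` of square roots of conductances has `c - U c` supported on `e`, so sums of `U ^ t e`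
telescope and stay bounded. Averaging `U ^ t e` over `t < T` with a clock register separates the two
cases once `T ^ 2` exceeds a constant times the total conductance times the energy of the flow
(`CoalescingWalk.exists_quantumRobot_evaluates_or`).

Quadratic growth of balls bounds a separated net at scale `2 ^ j` by `O(n / 4 ^ j)` points. Walking
from net to net, at doubling scales and times, leaves `O(n / (k + 1) ^ 2)` nodes in layer `k`
(`exists_coalescingWalk`). The total conductance is then `O(n log n)` and the energy `O(log n)`,
whence `O(√n log n)` steps. This one bound gives both parts. -/

/-! ### Extending local unitaries along an injection of bases -/

/-- C-locality of a matrix whose basis states sit at the vertices given by `loc`. -/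
def IsLocalAlong {V α : Type*} (G : SimpleGraph V) (loc : α → V) (M : Matrix α α ℂ) : Prop :=
  ∃ P : Setoid α, (∀ x y, ¬ P x y → M y x = 0) ∧
    ∀ x, ∃ v w : V, (v = w ∨ G.Adj v w) ∧ ∀ y, P x y → loc y = v ∨ loc y = w

/-- The matrix of the linear map sending the basis vector `x` to the basis vector `f x`. -/
def basisMap {α β : Type*} [DecidableEq β] (f : α → β) : Matrix β α ℂ :=
  Matrix.of fun y x => if y = f x then 1 else 0

/-- The extension of a matrix along `f`, acting as the identity outside of the range of `f`. -/
def extendMatrix {α β : Type*} [Fintype α] [DecidableEq α] [DecidableEq β] (f : α → β)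
    (M : Matrix α α ℂ) : Matrix β β ℂ :=
  1 + basisMap f * (M - 1) * (basisMap f).conjTranspose

section Extension

set_option linter.unusedSectionVars false

variable {α β γ : Type*} [Fintype α] [DecidableEq α] [Fintype β] [DecidableEq β] [DecidableEq γ]

lemma basisMap_conjTranspose_mul_self {f : α → β} (hf : Function.Injective f) :
    (basisMap f).conjTranspose * basisMap f = 1 := by
  ext x y
  simp [basisMap, Matrix.mul_apply, Matrix.one_apply, hf.eq_iff, eq_comm]

lemma basisMap_mulVec_apply {f : α → β} (hf : Function.Injective f) (v : α → ℂ) (x : α) :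
    (basisMap f).mulVec v (f x) = v x := by
  simp [basisMap, Matrix.mulVec, dotProduct, hf.eq_iff]

lemma basisMap_mulVec_of_notMem {f : α → β} (v : α → ℂ) {y : β} (hy : ∀ x, y ≠ f x) :
    (basisMap f).mulVec v y = 0 := by
  simp [basisMap, Matrix.mulVec, dotProduct, hy]

lemma basisMap_mulVec_single (f : α → β) (x : α) :
    (basisMap f).mulVec (Pi.single x 1) = Pi.single (f x) 1 := by
  ext y
  simp [basisMap, Pi.single_apply]

lemma basisMap_mul_basisMap (g : β → γ) (f : α → β) :
    basisMap g * basisMap f = basisMap (g ∘ f) := by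
  ext x y
  simp [basisMap, Matrix.mul_apply]

lemma diagonal_mul_basisMap (d : β → ℂ) (f : α → β) :
    Matrix.diagonal d * basisMap f = basisMap f * Matrix.diagonal (d ∘ f) := by
  ext y x
  by_cases h : y = f x <;> simp [basisMap, h]

lemma extendMatrix_mul_basisMap {f : α → β} (hf : Function.Injective f) (M : Matrix α α ℂ) :
    extendMatrix f M * basisMap f = basisMap f * M := by
  rw [extendMatrix, Matrix.add_mul, Matrix.mul_assoc, basisMap_conjTranspose_mul_self hf]
  simp [Matrix.mul_sub]

lemma extendMatrix_mem_unitaryGroup {f : α → β} (hf : Function.Injective f) {M : Matrix α α ℂ}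
    (hM : M ∈ Matrix.unitaryGroup α ℂ) : extendMatrix f M ∈ Matrix.unitaryGroup β ℂ := by
  rw [Matrix.mem_unitaryGroup_iff, Matrix.star_eq_conjTranspose] at hM ⊢
  -- Unitarity of `M`, expressed through the deviation `M - 1` that the extension transports.
  have key : (M - 1) + (M.conjTranspose - 1) + (M - 1) * (M.conjTranspose - 1) = 0 := by
    have : (M - 1) * (M.conjTranspose - 1) = M * M.conjTranspose - M - M.conjTranspose + 1 := by
      noncomm_ring
    rw [this, hM]; abel
  have hJ := basisMap_conjTranspose_mul_self hf
  set J := basisMap f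
  have h1 : (extendMatrix f M).conjTranspose
      = 1 + J * (M.conjTranspose - 1) * J.conjTranspose := by
    simp [extendMatrix, J, Matrix.conjTranspose_mul, Matrix.mul_assoc]
  rw [h1]
  calc (1 + J * (M - 1) * J.conjTranspose) * (1 + J * (M.conjTranspose - 1) * J.conjTranspose)
      = 1 + J * (M - 1) * J.conjTranspose + J * (M.conjTranspose - 1) * J.conjTranspose
        + J * (M - 1) * (J.conjTranspose * J) * (M.conjTranspose - 1) * J.conjTranspose := by
        simp only [Matrix.mul_add, Matrix.add_mul, Matrix.mul_one, Matrix.one_mul,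
          Matrix.mul_assoc]
        abel
    _ = 1 + J * ((M - 1) + (M.conjTranspose - 1) + (M - 1) * (M.conjTranspose - 1))
          * J.conjTranspose := by
        rw [hJ]; simp only [Matrix.mul_add, Matrix.add_mul, Matrix.mul_one, Matrix.mul_assoc]; abel
    _ = 1 := by rw [key]; simp

lemma extendMatrix_apply_of_ne {f : α → β} (M : Matrix α α ℂ) {x y : β} (hxy : y ≠ x)
    (h : ∀ a b, x = f a → y = f b → M b a = 0) : extendMatrix f M y x = 0 := by
  have h2 : ∀ a b, (if y = f b then (1 : ℂ) else 0) * (M - 1) b a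
      * (if x = f a then (1 : ℂ) else 0) = 0 := by
    intro a b
    split_ifs with h1 h2
    · have hab : b ≠ a := by rintro rfl; exact hxy (h1.trans h2.symm)
      simp [h a b h2 h1, Matrix.one_apply_ne hab]
    all_goals simp
  rw [extendMatrix, Matrix.add_apply, Matrix.one_apply_ne hxy, zero_add, Matrix.mul_apply]
  refine Finset.sum_eq_zero fun a _ => ?_
  rw [Matrix.mul_apply, Finset.sum_mul]
  refine Finset.sum_eq_zero fun b _ => ?_
  refine Eq.trans ?_ (h2 a b)
  simp only [basisMap, Matrix.of_apply, Matrix.conjTranspose_apply]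
  by_cases hx : x = f a <;> simp [hx]

lemma IsLocalAlong.extendMatrix {V : Type*} {G : SimpleGraph V} {loc : α → V} {locβ : β → V}
    {f : α → β} (hf : Function.Injective f) (hloc : ∀ x, locβ (f x) = loc x) {M : Matrix α α ℂ}
    (hM : IsLocalAlong G loc M) : IsLocalAlong G locβ (extendMatrix f M) := by
  obtain ⟨P, hP, hP'⟩ := hM
  refine ⟨⟨fun x y => x = y ∨ ∃ a b, x = f a ∧ y = f b ∧ P a b, ?_, ?_, ?_⟩, ?_, ?_⟩
  · exact fun x => Or.inl rfl
  · rintro x y (rfl | ⟨a, b, rfl, rfl, h⟩)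
    · exact Or.inl rfl
    · exact Or.inr ⟨b, a, rfl, rfl, P.symm h⟩
  · rintro x y z (rfl | ⟨a, b, rfl, rfl, h⟩) h'
    · exact h'
    · rcases h' with rfl | ⟨a', b', h1, rfl, h2⟩
      · exact Or.inr ⟨a, b, rfl, rfl, h⟩
      · cases hf h1
        exact Or.inr ⟨a, b', rfl, rfl, P.trans h h2⟩
  · intro x y hxy
    have hxy' : ¬ (x = y ∨ ∃ a b, x = f a ∧ y = f b ∧ P a b) := hxy
    push Not at hxy'
    exact extendMatrix_apply_of_ne M (Ne.symm hxy'.1) fun a b h1 h2 => hP _ _ (hxy'.2 a b h1 h2)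
  · intro x
    by_cases hx : ∃ a, x = f a
    · obtain ⟨a, rfl⟩ := hx
      obtain ⟨v, w, hvw, h⟩ := hP' a
      refine ⟨v, w, hvw, ?_⟩
      rintro y (rfl | ⟨a', b, h1, rfl, h2⟩)
      · rw [hloc]; exact h a (P.refl a)
      · cases hf h1
        rw [hloc]; exact h b h2
    · refine ⟨locβ x, locβ x, Or.inl rfl, ?_⟩
      rintro y (rfl | ⟨a, b, rfl, rfl, h⟩)
      · exact Or.inl rfl
      · exact absurd ⟨a, rfl⟩ hx

end Extension

/-! ### Simulating phase queries with the XOR oracle -/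

lemma diagonal_mem_unitaryGroup {α : Type*} [Fintype α] [DecidableEq α] (p : α → Prop)
    [DecidablePred p] :
    Matrix.diagonal (fun x => if p x then (-1 : ℂ) else 1) ∈ Matrix.unitaryGroup α ℂ := by
  rw [Matrix.mem_unitaryGroup_iff, Matrix.star_eq_conjTranspose, Matrix.diagonal_conjTranspose,
    Matrix.diagonal_mul_diagonal, ← Matrix.diagonal_one]
  congr 1
  ext x
  by_cases h : p x <;> simp [h]

lemma isLocalAlong_of_loc_eq {V α : Type*} (G : SimpleGraph V) (loc : α → V) {M : Matrix α α ℂ}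
    (h : ∀ x y, loc x ≠ loc y → M y x = 0) : IsLocalAlong G loc M :=
  ⟨Setoid.ker loc, fun x y hxy => h x y hxy, fun x => ⟨loc x, loc x, Or.inl rfl,
    fun _ hy => Or.inl (Eq.symm hy)⟩⟩

/-- Binary encodings of the elements of a finite type, with first bit `0`, another bit carrying
a given function `out`, and a given element encoded by the zero string. -/
lemma exists_encoding {α : Type*} [Fintype α] [DecidableEq α] (x₀ : α) (out : α → Bool)
    (h₀ : out x₀ = false) :
    ∃ (b : ℕ) (o : Fin (b + 1)) (enc : α → Fin (b + 1) → Bool),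
      Function.Injective enc ∧ (∀ x, enc x 0 = false) ∧ (enc x₀ = fun _ => false) ∧
      ∀ x, enc x o = out x := by
  let e := Fintype.equivFin α
  -- Bit `0` is the query bit, bit `1` the output bit, and the others are a one-hot code of `x`,
  -- suppressed at `x₀` so that `x₀` becomes the zero string.
  refine ⟨Fintype.card α + 1, 1, fun x i => if (i : ℕ) = 0 then false else if (i : ℕ) = 1 then out x
    else decide ((e x : ℕ) + 2 = i ∧ x ≠ x₀), ?_, ?_, ?_, ?_⟩
  · intro x y hxy
    by_contra hne
    have key : ∀ z : α, ∃ i : Fin (Fintype.card α + 1 + 1), (i : ℕ) = (e z : ℕ) + 2 := by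
      intro z
      exact ⟨⟨(e z : ℕ) + 2, by have := (e z).isLt; omega⟩, rfl⟩
    have hinj : ∀ z z' : α, (e z : ℕ) = e z' → z = z' := fun z z' h => e.injective (Fin.ext h)
    obtain ⟨i, hi⟩ := key x
    obtain ⟨j, hj⟩ := key y
    have h1 := congrFun hxy i
    have h2 := congrFun hxy j
    by_cases hx : x = x₀
    · subst hx
      have : y ≠ x := fun h => hne h.symm
      simp [hj, this] at h2
    · simp [hi, hx] at h1
      exact hne (hinj _ _ h1.1.symm)
  · simp
  · funext i
    by_cases h1 : (i : ℕ) = 0 <;> by_cases h2 : (i : ℕ) = 1 <;> simp [h2, h₀]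
  · intro x; simp

/-- The diagonal matrix flipping the sign of those basis states in `p` that sit at a marked
vertex. -/
def phaseQuery {V α : Type*} [DecidableEq α] (loc : α → V) (p : α → Bool)
    (X : V → Bool) : Matrix α α ℂ :=
  Matrix.diagonal fun x => if p x = true ∧ X (loc x) = true then -1 else 1

/-- The state after some rounds, each made of a unitary `L k` and a phase query on the basis
states in `p k`. -/
def phaseState {V α : Type*} [Fintype α] [DecidableEq α] (loc : α → V) (x₀ : α)
    (L : ℕ → Matrix α α ℂ) (p : ℕ → α → Bool) (X : V → Bool) : ℕ → α → ℂ
  | 0 => Pi.single x₀ 1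
  | k + 1 => (phaseQuery loc (p k) X).mulVec ((L k).mulVec (phaseState loc x₀ L p X k))

lemma oracleMatrix_eq_basisMap {V : Type*} [DecidableEq V] (b : ℕ) (X : V → Bool) :
    oracleMatrix b X = basisMap (queryBasis X) := rfl

/-- Two oracle steps make one phase query: the first sets the query bit exactly at marked vertices
(`f x` becomes `g x`), the diagonal step `D` negates the selected states whose bit is set, and the
second oracle step clears the bit. This accounts for the time `2 * k`. -/
theorem exists_quantumRobot_of_phaseState {V : Type*} [Fintype V] [DecidableEq V]
    (G : SimpleGraph V) {α : Type*} [Fintype α] [DecidableEq α] (loc : α → V) (x₀ : α)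
    (out : α → Bool) (h₀ : out x₀ = false) (L : ℕ → Matrix α α ℂ) (p : ℕ → α → Bool)
    (hL : ∀ k, L k ∈ Matrix.unitaryGroup α ℂ) (hLloc : ∀ k, IsLocalAlong G loc (L k)) :
    ∃ A : QuantumRobot G, ∀ X k c, A.outputProb (loc x₀) X (2 * k) c =
      ∑ x with out x = c, ‖phaseState loc x₀ L p X k x‖ ^ 2 := by
  classical
  obtain ⟨b, o, enc, henc, henc0, hencx, hout⟩ := exists_encoding x₀ out h₀
  let f : α → RobotBasis V b := fun x => (loc x, enc x)
  let g : α → RobotBasis V b := fun x => (loc x, Function.update (enc x) 0 true)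
  have hf : Function.Injective f := fun x y h => henc (congrArg Prod.snd h)
  have hg : Function.Injective g := by
    intro x y h
    apply henc
    have h2 : Function.update (enc x) 0 true = Function.update (enc y) 0 true :=
      congrArg Prod.snd h
    funext i
    by_cases hi : i = 0
    · subst hi; rw [henc0, henc0]
    · simpa [hi] using congrFun h2 i
  have hfg : ∀ x y, f x ≠ g y := by
    intro x y h
    have h2 : enc x = Function.update (enc y) 0 true := congrArg Prod.snd h
    have := congrFun h2 0
    simp [henc0] at this
  let D : ℕ → Matrix (RobotBasis V b) (RobotBasis V b) ℂ := fun k =>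
    Matrix.diagonal fun y => if ∃ x, y = g x ∧ p k x = true then -1 else 1
  let A : QuantumRobot G :=
    { workBits := b
      out := o
      step := fun t => if t % 2 = 0 then extendMatrix f (L (t / 2)) else D (t / 2)
      step_unitary := by
        intro t
        by_cases ht : t % 2 = 0
        · simp only [ht, if_true]; exact extendMatrix_mem_unitaryGroup hf (hL _)
        · simp only [ht, if_false]; exact diagonal_mem_unitaryGroup _
      step_local := by
        intro t
        by_cases ht : t % 2 = 0
        · simp only [ht, if_true]
          exact IsLocalAlong.extendMatrix (locβ := Prod.fst) hf (fun _ => rfl) (hLloc _)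
        · simp only [ht, if_false]
          exact isLocalAlong_of_loc_eq G Prod.fst fun x y hxy =>
            Matrix.diagonal_apply_ne _ fun h => hxy (by rw [h]) }
  have hquery : ∀ (X : V → Bool) x, queryBasis X (f x) = if X (loc x) then g x else f x := by
    intro X x
    cases hX : X (loc x)
    · simp only [queryBasis, f, hX, henc0]
      simp only [Bool.xor_false, Bool.false_eq_true, if_false]
      rw [← henc0 x, Function.update_eq_self]
    · simp [queryBasis, f, g, hX, henc0]
  have hquery' : ∀ (X : V → Bool) x, queryBasis X (queryBasis X (f x)) = f x := by
    intro X x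
    simp [queryBasis]
  have hD : ∀ (X : V → Bool) k, (oracleMatrix b X * D k * oracleMatrix b X) * basisMap f
      = basisMap f * phaseQuery loc (p k) X := by
    intro X k
    rw [oracleMatrix_eq_basisMap, Matrix.mul_assoc, basisMap_mul_basisMap, Matrix.mul_assoc,
      diagonal_mul_basisMap, ← Matrix.mul_assoc, basisMap_mul_basisMap]
    congr 1
    · congr 1; funext x; exact hquery' X x
    · rw [phaseQuery]
      congr 1
      funext x
      simp only [Function.comp_apply, hquery]
      cases hX : X (loc x)
      · simp [hfg]
      · simp [hg.eq_iff]
  have hstate : ∀ X k, A.state (loc x₀) X (2 * k)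
      = (basisMap f).mulVec (phaseState loc x₀ L p X k) := by
    intro X k
    induction k with
    | zero =>
      rw [phaseState, basisMap_mulVec_single]
      simp only [QuantumRobot.state]
      simp only [f, hencx]
      rfl
    | succ k ih =>
      have e1 : A.step (2 * k) = extendMatrix f (L k) := by
        simp [A]
      have e2 : A.step (2 * k + 1) = D k := by
        have h1 : (2 * k + 1) % 2 = 1 := by omega
        have h2 : (2 * k + 1) / 2 = k := by omega
        simp [A, h1, h2]
      have : 2 * (k + 1) = 2 * k + 1 + 1 := by ring
      rw [this, QuantumRobot.state, QuantumRobot.state, ih, e1, e2, phaseState]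
      change (oracleMatrix b X).mulVec ((D k).mulVec ((oracleMatrix b X).mulVec _)) = _
      rw [Matrix.mulVec_mulVec, Matrix.mulVec_mulVec, Matrix.mulVec_mulVec,
        Matrix.mulVec_mulVec, Matrix.mulVec_mulVec, Matrix.mulVec_mulVec, Matrix.mul_assoc _ _
        (basisMap f), extendMatrix_mul_basisMap hf, ← Matrix.mul_assoc _ (basisMap f), hD,
        Matrix.mul_assoc]
  refine ⟨A, fun X k c => ?_⟩
  rw [QuantumRobot.outputProb, hstate]
  symm
  refine Finset.sum_of_injOn f hf.injOn ?_ ?_ ?_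
  · intro x hx
    simpa [f, A, hout] using hx
  · intro y hy hy'
    rw [basisMap_mulVec_of_notMem]
    · simp
    · rintro x rfl
      apply hy'
      refine ⟨x, ?_, rfl⟩
      simpa [f, A, hout] using hy
  · intro x hx
    rw [basisMap_mulVec_apply hf]

/-! ### Reflections -/

lemma mem_unitaryGroup_of_involutive {α : Type*} [Fintype α] [DecidableEq α] {M : Matrix α α ℂ}
    (hM : M.conjTranspose = M) (h : ∀ v : α → ℂ, M.mulVec (M.mulVec v) = v) :
    M ∈ Matrix.unitaryGroup α ℂ := by
  rw [Matrix.mem_unitaryGroup_iff, Matrix.star_eq_conjTranspose, hM]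
  refine Matrix.ext_of_mulVec_single fun i => ?_
  rw [← Matrix.mulVec_mulVec, h, Matrix.one_mulVec]

/-- The orthogonal sum, over the fibres of `ν`, of the reflections that negate the restriction
of `c` to the fibre. -/
noncomputable def starReflection {α N : Type*} [Fintype α] [DecidableEq α] [DecidableEq N]
    (ν : α → N) (c : α → ℝ) : Matrix α α ℂ :=
  Matrix.of fun a b => (((if a = b then 1 else 0) -
    if ν b = ν a then 2 * c a / (∑ e with ν e = ν a, c e ^ 2) * c b else 0 : ℝ) : ℂ)

section StarReflection

variable {α N : Type*} [Fintype α] [DecidableEq α] [DecidableEq N] (ν : α → N) (c : α → ℝ)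

lemma starReflection_mulVec (v : α → ℂ) (a : α) :
    (starReflection ν c).mulVec v a = v a - 2 * (c a : ℂ) / (∑ e with ν e = ν a, (c e : ℂ) ^ 2) *
      ∑ b with ν b = ν a, (c b : ℂ) * v b := by
  have h1 : ∀ b, starReflection ν c a b * v b = (if a = b then v b else 0) -
      if ν b = ν a then 2 * (c a : ℂ) / (∑ e with ν e = ν a, (c e : ℂ) ^ 2) * (c b * v b)
        else 0 := by
    intro b
    by_cases h : ν b = ν a <;> by_cases h' : a = b <;>
      simp [starReflection, h, h', sub_mul, mul_assoc]
  simp only [Matrix.mulVec, dotProduct, h1, Finset.sum_sub_distrib]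
  rw [Finset.mul_sum, Finset.sum_ite_eq, if_pos (Finset.mem_univ a), ← Finset.sum_filter]

lemma starReflection_sum_mulVec (v : α → ℂ) (u : N) :
    ∑ b with ν b = u, (c b : ℂ) * (starReflection ν c).mulVec v b
      = - ∑ b with ν b = u, (c b : ℂ) * v b := by
  have h1 : ∀ b ∈ Finset.univ.filter (fun b => ν b = u),
      (c b : ℂ) * (starReflection ν c).mulVec v b = c b * v b -
        (c b : ℂ) ^ 2 * (2 / (∑ e with ν e = u, (c e : ℂ) ^ 2) *
          ∑ b with ν b = u, (c b : ℂ) * v b) := by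
    intro b hb
    obtain rfl := (Finset.mem_filter.1 hb).2
    rw [starReflection_mulVec]; ring
  rw [Finset.sum_congr rfl h1, Finset.sum_sub_distrib, ← Finset.sum_mul]
  -- On a fibre where `c` vanishes, division by zero makes the reflection the identity, and both
  -- sides are `0`.
  by_cases hS : ∑ e with ν e = u, (c e : ℂ) ^ 2 = 0
  · have hS' : ∑ e with ν e = u, c e ^ 2 = 0 := by exact_mod_cast hS
    rw [Finset.sum_eq_zero_iff_of_nonneg fun _ _ => sq_nonneg _] at hS'
    have : ∑ b with ν b = u, (c b : ℂ) * v b = 0 :=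
      Finset.sum_eq_zero fun b hb => by
        simp [(pow_eq_zero_iff two_ne_zero).1 (hS' b hb)]
    rw [this]; simp
  · field_simp
    ring

lemma starReflection_mem_unitaryGroup : starReflection ν c ∈ Matrix.unitaryGroup α ℂ := by
  refine mem_unitaryGroup_of_involutive ?_ fun v => ?_
  · ext a b
    simp only [starReflection, Matrix.conjTranspose_apply, Matrix.of_apply, RCLike.star_def,
      Complex.conj_ofReal]
    by_cases h : ν a = ν b
    · simp only [h, if_true, @eq_comm _ a b]
      push_cast; ring
    · simp [h, Ne.symm h, @eq_comm _ a b]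
  · ext a
    rw [starReflection_mulVec, starReflection_sum_mulVec, starReflection_mulVec]
    ring

lemma starReflection_mulVec_self :
    (starReflection ν c).mulVec (fun a => (c a : ℂ)) = fun a => -(c a : ℂ) := by
  ext a
  rw [starReflection_mulVec]
  by_cases hS : ∑ e with ν e = ν a, (c e : ℂ) ^ 2 = 0
  · have hS' : ∑ e with ν e = ν a, c e ^ 2 = 0 := by exact_mod_cast hS
    rw [Finset.sum_eq_zero_iff_of_nonneg fun _ _ => sq_nonneg _] at hS'
    have : c a = 0 := by simpa using hS' a (by simp)
    simp [this]
  · simp only [← sq]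
    field_simp
    ring

lemma starReflection_apply_of_ne {a b : α} (h : ν a ≠ ν b) : starReflection ν c b a = 0 := by
  have : b ≠ a := by rintro rfl; exact h rfl
  simp [starReflection, h, this]

end StarReflection

/-- The Householder reflection exchanging the basis vector at `i` with the uniform unit vector. For
`2 ≤ T` these two differ, so there is a vector to reflect in. -/
lemma exists_unitary_uniform {T : ℕ} (hT : 2 ≤ T) (i : Fin T) :
    ∃ F ∈ Matrix.unitaryGroup (Fin T) ℂ,
      (∀ j, F i j = ((1 / √T : ℝ) : ℂ)) ∧ ∀ j, F j i = ((1 / √T : ℝ) : ℂ) := by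
  set u : ℝ := 1 / √T with hu
  have hT' : (1 : ℝ) < T := by exact_mod_cast hT
  have hu2 : (T : ℝ) * u ^ 2 = 1 := by
    rw [hu, div_pow, Real.sq_sqrt (by linarith)]
    field_simp
  have hu1 : u ≠ 1 := by
    intro h
    rw [h] at hu2
    linarith
  let w : Fin T → ℝ := fun j => (if j = i then 1 else 0) - u
  have hS : ∑ j, w j ^ 2 = 2 * (1 - u) := by
    have : ∀ j, w j ^ 2 = (if j = i then 1 - 2 * u else 0) + u ^ 2 := by
      intro j
      by_cases h : j = i <;> simp [w, h]
      ring
    simp only [this, Finset.sum_add_distrib, Finset.sum_ite_eq', Finset.mem_univ, if_true,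
      Finset.sum_const, Finset.card_univ, Fintype.card_fin, nsmul_eq_mul, hu2]
    ring
  have hne : (1 - u) ≠ 0 := sub_ne_zero.2 (Ne.symm hu1)
  refine ⟨starReflection (fun _ : Fin T => ()) w, starReflection_mem_unitaryGroup _ _, ?_, ?_⟩
  · intro j
    simp only [starReflection, Matrix.of_apply, Finset.filter_true, if_true]
    rw [hS]
    congr 1
    by_cases h : i = j
    · subst h
      simp only [w, if_true]; field_simp; ring
    · simp only [w, h, Ne.symm h, if_true, if_false]; field_simp; ring
  · intro j
    simp only [starReflection, Matrix.of_apply, Finset.filter_true, if_true]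
    rw [hS]
    congr 1
    by_cases h : j = i
    · subst h
      simp only [w, if_true]; field_simp; ring
    · simp only [w, h, if_true, if_false]; field_simp; ring

/-! ### Averaged powers of a unitary -/

section Norm

variable {α : Type*} [Fintype α]

lemma sum_norm_sq_eq_dotProduct (v : α → ℂ) : ((∑ x, ‖v x‖ ^ 2 : ℝ) : ℂ) = star v ⬝ᵥ v := by
  simp [dotProduct, Complex.conj_mul']

lemma sum_norm_sq_mulVec [DecidableEq α] {M : Matrix α α ℂ} (hM : M ∈ Matrix.unitaryGroup α ℂ) (v : α → ℂ) :
    ∑ x, ‖M.mulVec v x‖ ^ 2 = ∑ x, ‖v x‖ ^ 2 := by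
  have hM' : M.conjTranspose * M = 1 := by
    rw [← Matrix.star_eq_conjTranspose]; exact Matrix.mem_unitaryGroup_iff'.1 hM
  have : ((∑ x, ‖M.mulVec v x‖ ^ 2 : ℝ) : ℂ) = ((∑ x, ‖v x‖ ^ 2 : ℝ) : ℂ) := by
    rw [sum_norm_sq_eq_dotProduct, sum_norm_sq_eq_dotProduct, Matrix.star_mulVec,
      ← Matrix.dotProduct_mulVec, Matrix.mulVec_mulVec, hM', Matrix.one_mulVec]
  exact_mod_cast this

lemma norm_sq_dotProduct_le (φ v : α → ℂ) :
    ‖star φ ⬝ᵥ v‖ ^ 2 ≤ (∑ x, ‖φ x‖ ^ 2) * ∑ x, ‖v x‖ ^ 2 := by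
  have h1 : ‖star φ ⬝ᵥ v‖ ≤ ∑ x, ‖φ x‖ * ‖v x‖ := by
    refine (norm_sum_le _ _).trans (le_of_eq ?_)
    simp
  calc ‖star φ ⬝ᵥ v‖ ^ 2 ≤ (∑ x, ‖φ x‖ * ‖v x‖) ^ 2 := by gcongr
    _ ≤ _ := Finset.sum_mul_sq_le_sq_mul_sq _ _ _

variable [DecidableEq α]

/-- A vector fixed by a unitary is fixed by its adjoint as well. -/
lemma star_dotProduct_pow_mulVec {U : Matrix α α ℂ} (hU : U ∈ Matrix.unitaryGroup α ℂ)
    {φ : α → ℂ} (hφ : U.mulVec φ = φ) (v : α → ℂ) (t : ℕ) :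
    star φ ⬝ᵥ (U ^ t).mulVec v = star φ ⬝ᵥ v := by
  have hU' : U.conjTranspose * U = 1 := by
    rw [← Matrix.star_eq_conjTranspose]; exact Matrix.mem_unitaryGroup_iff'.1 hU
  induction t with
  | zero => simp
  | succ t ih =>
    rw [pow_succ', ← Matrix.mulVec_mulVec]
    nth_rewrite 1 [← hφ]
    rw [Matrix.star_mulVec, ← Matrix.dotProduct_mulVec, Matrix.mulVec_mulVec, hU',
      Matrix.one_mulVec, ih]

/-- Every `U ^ t e` has the same inner product with `φ`, so the sum has inner product of modulus `T
* ‖φ e‖` with `φ`; Cauchy–Schwarz turns this into a lower bound on its norm. -/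
lemma sum_norm_sq_sum_pow_ge {U : Matrix α α ℂ} (hU : U ∈ Matrix.unitaryGroup α ℂ)
    {φ : α → ℂ} (hφ : U.mulVec φ = φ) (e : α) (T : ℕ) (he : φ e ≠ 0)
    (h : 2 * ∑ x, ‖φ x‖ ^ 2 ≤ 3 * ‖φ e‖ ^ 2) :
    2 / 3 * (T : ℝ) ^ 2 ≤
      ∑ a, ‖∑ t ∈ Finset.range T, (U ^ t).mulVec (Pi.single e 1) a‖ ^ 2 := by
  set w : α → ℂ := ∑ t ∈ Finset.range T, (U ^ t).mulVec (Pi.single e 1) with hw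
  have h1 : star φ ⬝ᵥ w = T * star (φ e) := by
    rw [hw, dotProduct_sum, Finset.sum_congr rfl fun t _ =>
      star_dotProduct_pow_mulVec hU hφ _ t]
    simp
  have h2 := norm_sq_dotProduct_le φ w
  rw [h1] at h2
  simp only [norm_mul, Complex.norm_natCast, norm_star, mul_pow] at h2
  have h3 : ∀ a, w a = ∑ t ∈ Finset.range T, (U ^ t).mulVec (Pi.single e 1) a := by
    intro a; rw [hw, Finset.sum_apply]
  simp only [h3] at h2
  have hpos : 0 < ‖φ e‖ ^ 2 := by positivity
  set W := ∑ a, ‖∑ t ∈ Finset.range T, (U ^ t).mulVec (Pi.single e 1) a‖ ^ 2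
  have hW : 0 ≤ W := by positivity
  have h4 : (T : ℝ) ^ 2 * ‖φ e‖ ^ 2 ≤ 3 / 2 * ‖φ e‖ ^ 2 * W :=
    h2.trans (by gcongr; linarith)
  have h5 : (T : ℝ) ^ 2 ≤ 3 / 2 * W := by
    refine le_of_mul_le_mul_right ?_ hpos
    linarith
  linarith

/-- Since `e` is a multiple of `c - U c`, the sum telescopes to `(c - U ^ T c) / (2 γ)`, whose norm
is at most `‖c‖ / γ` whatever `T` is. -/
lemma sum_norm_sq_sum_pow_le {U : Matrix α α ℂ} (hU : U ∈ Matrix.unitaryGroup α ℂ)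
    {c : α → ℂ} {γ : ℝ} (hγ : 0 < γ) (e : α) (T : ℕ)
    (hc : c - U.mulVec c = Pi.single e (2 * γ : ℂ))
    (h : 3 * ∑ x, ‖c x‖ ^ 2 ≤ γ ^ 2 * T ^ 2) :
    ∑ a, ‖∑ t ∈ Finset.range T, (U ^ t).mulVec (Pi.single e 1) a‖ ^ 2 ≤ 1 / 3 * (T : ℝ) ^ 2 := by
  have hs : (Pi.single e (1 : ℂ) : α → ℂ) = (2 * γ : ℂ)⁻¹ • (c - U.mulVec c) := by
    rw [hc, ← Pi.single_smul]
    have : (γ : ℂ) ≠ 0 := by exact_mod_cast hγ.ne'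
    congr 1
    rw [smul_eq_mul, inv_mul_cancel₀ (mul_ne_zero two_ne_zero this)]
  have h1 : ∀ a, ∑ t ∈ Finset.range T, (U ^ t).mulVec (Pi.single e 1) a
      = (2 * γ : ℂ)⁻¹ * (c a - (U ^ T).mulVec c a) := by
    intro a
    have : ∀ t, (U ^ t).mulVec (Pi.single e 1) a
        = (2 * γ : ℂ)⁻¹ * ((U ^ t).mulVec c a - (U ^ (t + 1)).mulVec c a) := by
      intro t
      rw [hs, Matrix.mulVec_smul, Matrix.mulVec_sub, Matrix.mulVec_mulVec, ← pow_succ]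
      simp
    simp only [this, ← Finset.mul_sum]
    rw [Finset.sum_range_sub' fun t => (U ^ t).mulVec c a]
    simp
  have hUT : ∑ x, ‖(U ^ T).mulVec c x‖ ^ 2 = ∑ x, ‖c x‖ ^ 2 :=
    sum_norm_sq_mulVec (pow_mem hU T) c
  have h2 : ∀ a, ‖∑ t ∈ Finset.range T, (U ^ t).mulVec (Pi.single e 1) a‖ ^ 2
      ≤ (2 * γ)⁻¹ ^ 2 * (2 * ‖c a‖ ^ 2 + 2 * ‖(U ^ T).mulVec c a‖ ^ 2) := by
    intro a
    rw [h1, norm_mul, mul_pow]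
    have e1 : ‖(2 * γ : ℂ)⁻¹‖ = (2 * γ)⁻¹ := by
      rw [norm_inv, norm_mul, Complex.norm_real, Real.norm_of_nonneg hγ.le]; simp
    rw [e1]
    gcongr
    have := norm_sub_le (c a) ((U ^ T).mulVec c a)
    have h0 := norm_nonneg (c a - (U ^ T).mulVec c a)
    nlinarith [sq_nonneg (‖c a‖ - ‖(U ^ T).mulVec c a‖)]
  refine (Finset.sum_le_sum fun a _ => h2 a).trans ?_
  rw [← Finset.mul_sum, Finset.sum_add_distrib, ← Finset.mul_sum, ← Finset.mul_sum, hUT]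
  rw [inv_pow, inv_mul_le_iff₀ (by positivity)]
  nlinarith

end Norm

/-! ### Implementing the average with a clock register -/

lemma blockDiagonal_mulVec {α τ : Type*} [Fintype α] [Fintype τ] [DecidableEq τ]
    (M : τ → Matrix α α ℂ) (v : α × τ → ℂ) (x : α × τ) :
    (Matrix.blockDiagonal M).mulVec v x = (M x.2).mulVec (fun a => v (a, x.2)) x.1 := by
  simp [Matrix.mulVec, dotProduct, Matrix.blockDiagonal_apply, Fintype.sum_prod_type]

lemma blockDiagonal_mem_unitaryGroup {α τ : Type*} [Fintype α] [DecidableEq α] [Fintype τ]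
    [DecidableEq τ] {M : τ → Matrix α α ℂ} (hM : ∀ t, M t ∈ Matrix.unitaryGroup α ℂ) :
    Matrix.blockDiagonal M ∈ Matrix.unitaryGroup (α × τ) ℂ := by
  rw [Matrix.mem_unitaryGroup_iff, Matrix.star_eq_conjTranspose,
    Matrix.blockDiagonal_conjTranspose, ← Matrix.blockDiagonal_mul, ← Matrix.blockDiagonal_one]
  congr 1
  ext1 t
  exact Matrix.mem_unitaryGroup_iff.1 (hM t)

lemma one_kronecker_mulVec {α τ : Type*} [Fintype α] [DecidableEq α] [Fintype τ]
    (F : Matrix τ τ ℂ) (v : α × τ → ℂ) (x : α × τ) :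
    (Matrix.kronecker (1 : Matrix α α ℂ) F).mulVec v x = ∑ t, F x.2 t * v (x.1, t) := by
  simp [Matrix.mulVec, dotProduct, Matrix.kronecker, Matrix.kroneckerMap_apply,
    Fintype.sum_prod_type, Matrix.one_apply, ite_mul]

lemma isLocalAlong_one {V α : Type*} [DecidableEq α] (G : SimpleGraph V) (loc : α → V) :
    IsLocalAlong G loc (1 : Matrix α α ℂ) :=
  isLocalAlong_of_loc_eq G loc fun _ _ h => Matrix.one_apply_ne fun h' => h (by rw [h'])

lemma IsLocalAlong.blockDiagonal {V α τ : Type*} [DecidableEq τ] {G : SimpleGraph V}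
    {loc : α → V} {M : τ → Matrix α α ℂ} (hM : ∀ t, IsLocalAlong G loc (M t)) :
    IsLocalAlong G (fun x : α × τ => loc x.1) (Matrix.blockDiagonal M) := by
  choose P hP hP' using hM
  refine ⟨⟨fun x y => x.2 = y.2 ∧ P x.2 x.1 y.1, fun x => ⟨rfl, (P x.2).refl _⟩, ?_, ?_⟩, ?_, ?_⟩
  · rintro ⟨a, t⟩ ⟨b, t'⟩ ⟨h, h'⟩
    dsimp only at h h' ⊢
    subst h
    exact ⟨rfl, (P t).symm h'⟩
  · rintro ⟨a, t⟩ ⟨b, t'⟩ ⟨c, t''⟩ ⟨h1, h2⟩ ⟨h3, h4⟩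
    dsimp only at h1 h2 h3 h4 ⊢
    subst h1 h3
    exact ⟨rfl, (P t).trans h2 h4⟩
  · rintro ⟨a, t⟩ ⟨b, t'⟩ h
    have h' : ¬ (t = t' ∧ P t a b) := h
    rw [Matrix.blockDiagonal_apply]
    by_cases ht : t = t'
    · subst ht
      simp only [true_and] at h'
      simp [hP t a b h']
    · simp [Ne.symm ht]
  · rintro ⟨a, t⟩
    obtain ⟨v, w, hvw, h⟩ := hP' t a
    refine ⟨v, w, hvw, ?_⟩
    rintro ⟨b, t'⟩ ⟨-, h'⟩
    exact h b h'

lemma isLocalAlong_one_kronecker {V α τ : Type*} [DecidableEq α] (G : SimpleGraph V)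
    (loc : α → V) (F : Matrix τ τ ℂ) :
    IsLocalAlong G (fun x : α × τ => loc x.1) (Matrix.kronecker (1 : Matrix α α ℂ) F) := by
  refine isLocalAlong_of_loc_eq G _ fun x y h => ?_
  have : y.1 ≠ x.1 := fun h' => h (by rw [h'])
  simp [Matrix.kronecker, Matrix.kroneckerMap_apply, this]

lemma phaseQuery_mem_unitaryGroup {V α : Type*} [Fintype α] [DecidableEq α] (loc : α → V)
    (p : α → Bool) (X : V → Bool) : phaseQuery loc p X ∈ Matrix.unitaryGroup α ℂ :=
  diagonal_mem_unitaryGroup _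

lemma sum_norm_sq_phaseState {V α : Type*} [Fintype α] [DecidableEq α] (loc : α → V) (x₀ : α)
    (L : ℕ → Matrix α α ℂ) (p : ℕ → α → Bool) (X : V → Bool)
    (hL : ∀ k, L k ∈ Matrix.unitaryGroup α ℂ) (k : ℕ) :
    ∑ x, ‖phaseState loc x₀ L p X k x‖ ^ 2 = 1 := by
  induction k with
  | zero =>
    rw [Finset.sum_eq_single x₀] <;> simp +contextual [phaseState]
  | succ k ih =>
    rw [phaseState, sum_norm_sq_mulVec (phaseQuery_mem_unitaryGroup _ _ _),
      sum_norm_sq_mulVec (hL k), ih]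

/-- The unitaries applied by the algorithm that averages the powers of a product of `S` with a
phase query and `R` over a clock register: `F₀` and `F₁` act on the clock, and round `τ` is
applied only if the clock shows more than `τ`. -/
def averagingStep {α : Type*} [DecidableEq α] {T : ℕ} (R S : Matrix α α ℂ)
    (F₀ F₁ : Matrix (Fin T) (Fin T) ℂ) (k : ℕ) : Matrix (α × Fin T) (α × Fin T) ℂ :=
  if k = 0 then Matrix.kronecker 1 F₀
  else if k = 2 * T + 1 then Matrix.kronecker 1 F₁
  else Matrix.blockDiagonal fun t =>
    if (k - 1) / 2 < (t : ℕ) then (if k % 2 = 1 then R else S) else 1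

/-- The basis states subject to a phase query after the `k`-th step of `averagingStep`. -/
def averagingPhase {α : Type*} {T : ℕ} (leaf : α → Bool) (k : ℕ) (x : α × Fin T) : Bool :=
  leaf x.1 && decide (k % 2 = 1 ∧ k ≠ 2 * T + 1 ∧ (k - 1) / 2 < (x.2 : ℕ))

section Averaging

variable {V α : Type*} [Fintype α] [DecidableEq α]

lemma averagingStep_mem_unitaryGroup {T : ℕ} {R S : Matrix α α ℂ}
    {F₀ F₁ : Matrix (Fin T) (Fin T) ℂ} (hR : R ∈ Matrix.unitaryGroup α ℂ)
    (hS : S ∈ Matrix.unitaryGroup α ℂ) (hF₀ : F₀ ∈ Matrix.unitaryGroup (Fin T) ℂ)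
    (hF₁ : F₁ ∈ Matrix.unitaryGroup (Fin T) ℂ) (k : ℕ) :
    averagingStep R S F₀ F₁ k ∈ Matrix.unitaryGroup (α × Fin T) ℂ := by
  unfold averagingStep
  split_ifs
  · exact Matrix.kronecker_mem_unitary (one_mem _) hF₀
  · exact Matrix.kronecker_mem_unitary (one_mem _) hF₁
  · refine blockDiagonal_mem_unitaryGroup fun t => ?_
    split_ifs
    exacts [hR, one_mem _]
  · refine blockDiagonal_mem_unitaryGroup fun t => ?_
    split_ifs
    exacts [hS, one_mem _]

omit [Fintype α] in
lemma averagingStep_isLocalAlong {G : SimpleGraph V} {loc : α → V} {T : ℕ} {R S : Matrix α α ℂ}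
    (F₀ F₁ : Matrix (Fin T) (Fin T) ℂ) (hR : IsLocalAlong G loc R) (hS : IsLocalAlong G loc S)
    (k : ℕ) : IsLocalAlong G (fun x : α × Fin T => loc x.1) (averagingStep R S F₀ F₁ k) := by
  unfold averagingStep
  split_ifs
  · exact isLocalAlong_one_kronecker G loc F₀
  · exact isLocalAlong_one_kronecker G loc F₁
  · refine IsLocalAlong.blockDiagonal fun t => ?_
    split_ifs
    exacts [hR, isLocalAlong_one G loc]
  · refine IsLocalAlong.blockDiagonal fun t => ?_
    split_ifs
    exacts [hS, isLocalAlong_one G loc]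

lemma phaseQuery_mulVec (loc : α → V) (p : α → Bool) (X : V → Bool) (v : α → ℂ) (a : α) :
    (phaseQuery loc p X).mulVec v a = if p a = true ∧ X (loc a) = true then -v a else v a := by
  rw [phaseQuery, Matrix.mulVec_diagonal]
  split_ifs <;> simp

/-- One application of `U` takes two rounds (`R` with the query, then `S`), after one round
preparing the clock. The branch with clock value `t` idles after `t` applications, hence the
exponent `min k t`. -/
lemma phaseState_averagingStep {loc : α → V} {leaf : α → Bool} {X : V → Bool} {e : α} {T : ℕ}
    {R S : Matrix α α ℂ} {F₀ F₁ : Matrix (Fin T) (Fin T) ℂ} {i : Fin T} {u : ℂ}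
    (hF₀ : ∀ j, F₀ j i = u) (k : ℕ) (hk : k ≤ T) :
    phaseState (fun x : α × Fin T => loc x.1) (e, i) (averagingStep R S F₀ F₁)
      (averagingPhase leaf) X (2 * k + 1) = fun x =>
        u * ((S * phaseQuery loc leaf X * R) ^ (min k x.2)).mulVec (Pi.single e 1) x.1 := by
  induction k with
  | zero =>
    ext x
    rw [phaseState, phaseQuery_mulVec, phaseState]
    simp only [averagingStep, averagingPhase, if_true]
    rw [one_kronecker_mulVec]
    by_cases hx : x.1 = e <;>
      simp [Pi.single_apply, hx, hF₀]
  | succ k ih =>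
    have h1 : 2 * (k + 1) + 1 = 2 * k + 1 + 1 + 1 := by ring
    rw [h1, phaseState, phaseState, ih (by omega)]
    ext ⟨a, t⟩
    have e1 : averagingStep R S F₀ F₁ (2 * k + 1 + 1) = Matrix.blockDiagonal fun t : Fin T =>
        if k < (t : ℕ) then S else 1 := by
      have h2 : (2 * k + 1 + 1 - 1) / 2 = k := by omega
      have h3 : (2 * k + 1 + 1) % 2 ≠ 1 := by omega
      have h4 : 2 * k + 1 + 1 ≠ 2 * T + 1 := by omega
      simp only [averagingStep, h2, h3, h4, if_false, Nat.succ_ne_zero]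
    have e2 : averagingStep R S F₀ F₁ (2 * k + 1) = Matrix.blockDiagonal fun t : Fin T =>
        if k < (t : ℕ) then R else 1 := by
      have h2 : (2 * k + 1 - 1) / 2 = k := by omega
      have h3 : (2 * k + 1) % 2 = 1 := by omega
      have h4 : 2 * k + 1 ≠ 2 * T + 1 := by omega
      simp only [averagingStep, h2, h3, h4, if_false, if_true, Nat.succ_ne_zero]
    have e3 : ∀ x : α × Fin T, averagingPhase leaf (2 * k + 1 + 1) x = false := by
      intro x
      have h3 : (2 * k + 1 + 1) % 2 ≠ 1 := by omega
      simp [averagingPhase, h3]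
    have e4 : ∀ x : α × Fin T, averagingPhase leaf (2 * k + 1) x
        = (leaf x.1 && decide (k < (x.2 : ℕ))) := by
      intro x
      have h2 : (2 * k + 1 - 1) / 2 = k := by omega
      have h3 : (2 * k + 1) % 2 = 1 := by omega
      have h4 : 2 * k + 1 ≠ 2 * T + 1 := by omega
      simp only [averagingPhase, h2, h3, ne_eq, h4, not_false_eq_true, true_and]
    rw [phaseQuery_mulVec, e3, e1, e2]
    simp only [Bool.false_eq_true, false_and, if_false]
    rw [blockDiagonal_mulVec]
    have e5 : ∀ (M : Matrix α α ℂ) (v : α → ℂ),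
        M.mulVec (fun a => u * v a) = fun a => u * M.mulVec v a :=
      fun M v => Matrix.mulVec_smul M u v
    by_cases hkt : k < (t : ℕ)
    · have hmin : min k (t : ℕ) = k := by omega
      have hmin' : min (k + 1) (t : ℕ) = k + 1 := by omega
      have e6 : (fun a => (phaseQuery (fun x : α × Fin T => loc x.1) (averagingPhase leaf (2 * k + 1))
          X).mulVec ((Matrix.blockDiagonal fun t : Fin T => if k < (t : ℕ) then R else 1).mulVec
            fun x => u * ((S * phaseQuery loc leaf X * R) ^ (min k x.2)).mulVec (Pi.single e 1) x.1)
              (a, t)) = (phaseQuery loc leaf X).mulVec (R.mulVec fun a => u *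
                ((S * phaseQuery loc leaf X * R) ^ k).mulVec (Pi.single e 1) a) := by
        ext b
        rw [phaseQuery_mulVec, phaseQuery_mulVec, blockDiagonal_mulVec, e4]
        simp [hkt, hmin]
      rw [e6]
      simp only [hkt, if_true, hmin', e5]
      rw [pow_succ']
      simp only [Matrix.mulVec_mulVec, Matrix.mul_assoc]
    · have hmin : min k (t : ℕ) = t := by omega
      have hmin' : min (k + 1) (t : ℕ) = t := by omega
      simp only [hkt, if_false, Matrix.one_mulVec, hmin']
      rw [phaseQuery_mulVec, blockDiagonal_mulVec, e4]
      simp [hkt, hmin]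

/-- The clock is spread uniformly, controls the power of `U`, and is then projected on the uniform
state; the amplitude that remains is the average of the `U ^ t e`. Its squared norm, the probability
of answering `true`, is at least `2/3` if `U` has a suitable fixed vector and at most `1/3` if `e`
is a suitable coboundary. -/
theorem exists_quantumRobot_evaluates_or [Fintype V] [DecidableEq V] (G : SimpleGraph V)
    (loc : α → V) (e : α) (leaf : α → Bool) {R S : Matrix α α ℂ}
    (hR : R ∈ Matrix.unitaryGroup α ℂ) (hS : S ∈ Matrix.unitaryGroup α ℂ)
    (hRloc : IsLocalAlong G loc R) (hSloc : IsLocalAlong G loc S) {T : ℕ} (hT : 2 ≤ T)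
    (hneg : ∃ (c : α → ℂ) (γ : ℝ), 0 < γ ∧ c - (S * R).mulVec c = Pi.single e (2 * γ : ℂ) ∧
      3 * ∑ x, ‖c x‖ ^ 2 ≤ γ ^ 2 * T ^ 2)
    (hpos : ∀ X v, X v = true → ∃ φ : α → ℂ,
      S.mulVec ((phaseQuery loc leaf X).mulVec (R.mulVec φ)) = φ ∧ φ e ≠ 0 ∧
      2 * ∑ x, ‖φ x‖ ^ 2 ≤ 3 * ‖φ e‖ ^ 2) :
    ∃ A : QuantumRobot G, A.Evaluates (loc e) orFunction (4 * T + 4) := by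
  have hT0 : (0 : ℝ) < T := by exact_mod_cast (by omega : 0 < T)
  let i : Fin T := ⟨0, by omega⟩
  -- The accepting clock value must differ from the initial one, since the initial state is encoded
  -- with output bit `0`.
  let j : Fin T := ⟨1, by omega⟩
  have hij : i ≠ j := by simp [i, j]
  obtain ⟨F₀, hF₀, -, hF₀'⟩ := exists_unitary_uniform hT i
  obtain ⟨F₁, hF₁, hF₁', -⟩ := exists_unitary_uniform hT j
  have hL := averagingStep_mem_unitaryGroup hR hS hF₀ hF₁
  obtain ⟨A, hA⟩ := exists_quantumRobot_of_phaseState G (fun x : α × Fin T => loc x.1) (e, i)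
    (fun x => decide (x.2 = j)) (by simp [hij]) (averagingStep R S F₀ F₁) (averagingPhase leaf)
    hL (averagingStep_isLocalAlong F₀ F₁ hRloc hSloc)
  refine ⟨A, fun X => ?_⟩
  -- There are `2 * T` rounds for the powers and two for the clock, each costing two robot steps.
  have htime : 4 * T + 4 = 2 * (2 * T + 1 + 1) := by ring
  set U := S * phaseQuery loc leaf X * R with hU
  have hUu : U ∈ Matrix.unitaryGroup α ℂ :=
    mul_mem (mul_mem hS (phaseQuery_mem_unitaryGroup _ _ _)) hR
  have hfinal : ∀ a, phaseState (fun x : α × Fin T => loc x.1) (e, i) (averagingStep R S F₀ F₁)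
      (averagingPhase leaf) X (2 * T + 1 + 1) (a, j)
        = (1 / T : ℝ) * ∑ t ∈ Finset.range T, (U ^ t).mulVec (Pi.single e 1) a := by
    intro a
    have h1 : ∀ x : α × Fin T, averagingPhase leaf (2 * T + 1) x = false := by
      intro x; simp [averagingPhase]
    have h2 : averagingStep R S F₀ F₁ (2 * T + 1) = Matrix.kronecker 1 F₁ := by
      simp [averagingStep]
    rw [phaseState, phaseQuery_mulVec, h1, h2, one_kronecker_mulVec,
      phaseState_averagingStep hF₀' T le_rfl]
    simp only [Bool.false_eq_true, false_and, if_false, hF₁']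
    rw [Finset.mul_sum, ← Fin.sum_univ_eq_sum_range (fun t =>
      ((1 / T : ℝ) : ℂ) * (U ^ t).mulVec (Pi.single e 1) a)]
    refine Finset.sum_congr rfl fun t _ => ?_
    rw [min_eq_right t.isLt.le, ← mul_assoc]
    congr 1
    rw [← Complex.ofReal_mul]
    congr 1
    rw [div_mul_div_comm, Real.mul_self_sqrt hT0.le, one_mul]
  have hprob : A.outputProb (loc e) X (4 * T + 4) true = (1 / T : ℝ) ^ 2 *
      ∑ a, ‖∑ t ∈ Finset.range T, (U ^ t).mulVec (Pi.single e 1) a‖ ^ 2 := by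
    rw [htime, hA, Finset.sum_filter, Fintype.sum_prod_type, Finset.mul_sum]
    refine Finset.sum_congr rfl fun a _ => ?_
    simp only [decide_eq_true_eq, Finset.sum_ite_eq', Finset.mem_univ, if_true, hfinal]
    rw [norm_mul, mul_pow, Complex.norm_real, Real.norm_of_nonneg (by positivity)]
  have hprob' : A.outputProb (loc e) X (4 * T + 4) false
      = 1 - A.outputProb (loc e) X (4 * T + 4) true := by
    rw [htime, hA, hA, eq_sub_iff_add_eq, ← sum_norm_sq_phaseState (fun x : α × Fin T => loc x.1)
      (e, i) (averagingStep R S F₀ F₁) (averagingPhase leaf) X hL (2 * T + 1 + 1), add_comm]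
    rw [← Finset.sum_filter_add_sum_filter_not Finset.univ
      (fun x : α × Fin T => decide (x.2 = j) = true)]
    simp
  by_cases hX : ∃ v, X v = true
  · have hor : orFunction X = true := by simpa [orFunction] using hX
    obtain ⟨v, hv⟩ := hX
    obtain ⟨φ, hφ, hφe, hφn⟩ := hpos X v hv
    have := sum_norm_sq_sum_pow_ge hUu (φ := φ)
      (by rw [hU, ← Matrix.mulVec_mulVec, ← Matrix.mulVec_mulVec]; exact hφ) e T hφe hφn
    rw [hor, hprob]
    calc (2 / 3 : ℝ) = (1 / T : ℝ) ^ 2 * (2 / 3 * (T : ℝ) ^ 2) := by field_simp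
      _ ≤ _ := by gcongr
  · have hor : orFunction X = false := by simpa [orFunction] using hX
    push Not at hX
    have hQ : phaseQuery loc leaf X = 1 := by
      rw [phaseQuery, ← Matrix.diagonal_one]
      congr 1
      ext x
      simp [hX]
    obtain ⟨c, γ, hγ, hc, hcn⟩ := hneg
    have := sum_norm_sq_sum_pow_le hUu hγ e T (by rw [hU, hQ, Matrix.mul_one]; exact hc) hcn
    rw [hor, hprob', hprob]
    have h2 : (1 / T : ℝ) ^ 2 *
        ∑ a, ‖∑ t ∈ Finset.range T, (U ^ t).mulVec (Pi.single e 1) a‖ ^ 2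
        ≤ (1 / T : ℝ) ^ 2 * (1 / 3 * (T : ℝ) ^ 2) := by gcongr
    have h3 : (1 / T : ℝ) ^ 2 * (1 / 3 * (T : ℝ) ^ 2) = 1 / 3 := by field_simp
    linarith

end Averaging

/-! ### Signed permutations -/

/-- The matrix of a signed permutation `(S v) x = g x * v (σ x)`. -/
def signedPermutation {α : Type*} [DecidableEq α] (σ : α → α) (g : α → ℝ) : Matrix α α ℂ :=
  Matrix.of fun x y => if y = σ x then (g x : ℂ) else 0

section SignedPermutation

variable {α : Type*} [DecidableEq α] {σ : α → α} {g : α → ℝ}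

lemma signedPermutation_mulVec [Fintype α] (v : α → ℂ) (x : α) :
    (signedPermutation σ g).mulVec v x = g x * v (σ x) := by
  simp [signedPermutation, Matrix.mulVec, dotProduct]

lemma signedPermutation_mem_unitaryGroup [Fintype α] (hσ : ∀ x, σ (σ x) = x)
    (hg : ∀ x, g x * g x = 1) (hgσ : ∀ x, g (σ x) = g x) :
    signedPermutation σ g ∈ Matrix.unitaryGroup α ℂ := by
  refine mem_unitaryGroup_of_involutive ?_ fun v => ?_
  · ext x y
    by_cases h : y = σ x
    · subst h; simp [signedPermutation, hσ, hgσ]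
    · have h' : x ≠ σ y := fun h' => h (by rw [h', hσ])
      simp [signedPermutation, h, h']
  · ext x
    rw [signedPermutation_mulVec, signedPermutation_mulVec, hσ, hgσ, ← mul_assoc,
      ← Complex.ofReal_mul, hg]
    simp

lemma signedPermutation_isLocalAlong {V : Type*} {G : SimpleGraph V} {loc : α → V}
    (hσ : ∀ x, σ (σ x) = x) (hloc : ∀ x, loc x = loc (σ x) ∨ G.Adj (loc x) (loc (σ x))) :
    IsLocalAlong G loc (signedPermutation σ g) := by
  refine ⟨⟨fun x y => x = y ∨ y = σ x, fun x => Or.inl rfl, ?_, ?_⟩, ?_, ?_⟩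
  · rintro x y (rfl | rfl)
    · exact Or.inl rfl
    · exact Or.inr (hσ x).symm
  · rintro x y z (rfl | rfl) (rfl | rfl)
    · exact Or.inl rfl
    · exact Or.inr rfl
    · exact Or.inr rfl
    · exact Or.inl (hσ x).symm
  · intro x y h
    have h' : ¬ (x = y ∨ y = σ x) := h
    have : x ≠ σ y := fun hx => h' (Or.inr (by rw [hx, hσ]))
    simp [signedPermutation, this]
  · intro x
    refine ⟨loc x, loc (σ x), hloc x, ?_⟩
    rintro y (rfl | rfl)
    · exact Or.inl rfl
    · exact Or.inr rfl

end SignedPermutation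

/-! ### Coalescing walks and their electric networks -/

/-- Walks on `G` from all the vertices to `s`, of the same length `len`, that coalesce. At time `k`
the walks carry labels in `nodes k`, a walk labelled `p` sits at the vertex `pos k p`, and its
next label is `next k p`. -/
structure CoalescingWalk {V : Type*} [Fintype V] (G : SimpleGraph V) (s : V) where
  len : ℕ
  len_pos : 0 < len
  nodes : ℕ → Finset V
  next : ℕ → V → V
  pos : ℕ → V → V
  nodes_zero : nodes 0 = Finset.univ
  nodes_len : nodes len = {s}
  next_mem : ∀ k, k < len → ∀ p ∈ nodes k, next k p ∈ nodes (k + 1)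
  pos_zero : ∀ p, pos 0 p = p
  pos_len : pos len s = s
  adj : ∀ k p, pos k p = pos (k + 1) (next k p) ∨ G.Adj (pos k p) (pos (k + 1) (next k p))

namespace CoalescingWalk

variable {V : Type*} [Fintype V] {G : SimpleGraph V} {s : V} (W : CoalescingWalk G s)

/-- The arcs of the layered network of a coalescing walk: the edge `(k, p)` joins the node `p` of
layer `k` to the node `next k p` of layer `k + 1`; the first component tells the upper end. -/
abbrev Arc : Type _ := Bool × Fin (W.len + 1) × V

/-- The node at which an arc starts. -/
def node (x : W.Arc) : ℕ × V :=
  if x.1 then (x.2.1 + 1, W.next x.2.1 x.2.2) else (x.2.1, x.2.2)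

/-- The vertex of `G` at which an arc starts. -/
def arcPos (x : W.Arc) : V := W.pos (W.node x).1 (W.node x).2

/-- The reversal of an arc; the arcs of the last layer are their own reversals. -/
def flip (x : W.Arc) : W.Arc := if (x.2.1 : ℕ) < W.len then (!x.1, x.2) else x

/-- The sign picked up by an arc on reversal. -/
def flipSign (x : W.Arc) : ℝ := if (x.2.1 : ℕ) < W.len then -1 else 1

/-- The labels along the walk starting at `v`. -/
def label (v : V) : ℕ → V
  | 0 => v
  | k + 1 => W.next k (label v k)

/-- The initial arc. -/
def start : W.Arc := (false, Fin.last W.len, s)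

lemma label_mem (v : V) (k : ℕ) (hk : k ≤ W.len) : W.label v k ∈ W.nodes k := by
  induction k with
  | zero => simp [W.nodes_zero]
  | succ k ih => exact W.next_mem k (by omega) _ (ih (by omega))

lemma label_len (v : V) : W.label v W.len = s := by
  simpa [W.nodes_len] using W.label_mem v W.len le_rfl

lemma flip_flip (x : W.Arc) : W.flip (W.flip x) = x := by
  by_cases h : (x.2.1 : ℕ) < W.len <;> simp [flip, h]

lemma flipSign_mul_self (x : W.Arc) : W.flipSign x * W.flipSign x = 1 := by
  by_cases h : (x.2.1 : ℕ) < W.len <;> simp [flipSign, h]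

lemma flipSign_flip (x : W.Arc) : W.flipSign (W.flip x) = W.flipSign x := by
  by_cases h : (x.2.1 : ℕ) < W.len <;> simp [flipSign, flip, h]

lemma arcPos_flip (x : W.Arc) :
    W.arcPos x = W.arcPos (W.flip x) ∨ G.Adj (W.arcPos x) (W.arcPos (W.flip x)) := by
  obtain ⟨b, k, p⟩ := x
  by_cases h : (k : ℕ) < W.len
  · have := W.adj k p
    cases b
    · simpa [arcPos, flip, h, node] using this
    · simp only [arcPos, flip, h, node, if_true, Bool.not_true, Bool.false_eq_true, if_false]
      rcases this with h1 | h1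
      · exact Or.inl h1.symm
      · exact Or.inr h1.symm
  · simp [flip, h]

lemma sum_arc {M : Type*} [AddCommMonoid M] (f : W.Arc → M) :
    ∑ x, f x = (∑ k : Fin W.len, ∑ p, f (true, k.castSucc, p) + ∑ p, f (true, Fin.last _, p))
      + (∑ k : Fin W.len, ∑ p, f (false, k.castSucc, p) + ∑ p, f (false, Fin.last _, p)) := by
  rw [Fintype.sum_prod_type, Fintype.sum_bool, Fintype.sum_prod_type, Fintype.sum_prod_type,
    Fin.sum_univ_castSucc, Fin.sum_univ_castSucc]

variable [DecidableEq V]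

/-- The square roots of the conductances, the last edge having conductance `w`. -/
noncomputable def amp (w : ℝ) (x : W.Arc) : ℝ :=
  if (x.2.1 : ℕ) < W.len then (if x.2.2 ∈ W.nodes x.2.1 then √((x.2.1 : ℕ) + 1 : ℝ) else 0)
  else if x.1 = false ∧ x.2.2 = s then √w else 0

/-- The unit flow along the walk starting at `v`, normalized by the amplitudes. -/
noncomputable def flow (w : ℝ) (v : V) (x : W.Arc) : ℝ :=
  if (x.2.1 : ℕ) < W.len then
    (if x.2.2 = W.label v x.2.1 then (if x.1 then 1 else -1) / √((x.2.1 : ℕ) + 1 : ℝ) else 0)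
  else if x.1 = false ∧ x.2.2 = s then -1 / √w else 0

/-- The total conductance; the factor `2` counts both orientations of an edge, while the dangling
arc at `s` is its own reversal. -/
lemma sum_amp_sq {w : ℝ} (hw : 0 < w) :
    ∑ x, W.amp w x ^ 2
      = w + 2 * ∑ k ∈ Finset.range W.len, (k + 1 : ℝ) * (W.nodes k).card := by
  have h1 : ∀ b (k : Fin W.len), ∑ p, W.amp w (b, k.castSucc, p) ^ 2
      = ((k : ℕ) + 1 : ℝ) * (W.nodes k).card := by
    intro b k
    have : ∀ p, W.amp w (b, k.castSucc, p) ^ 2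
        = if p ∈ W.nodes k then ((k : ℕ) + 1 : ℝ) else 0 := by
      intro p
      by_cases hp : p ∈ W.nodes k
      · simp only [amp, Fin.val_castSucc, k.isLt, if_true, hp]
        exact Real.sq_sqrt (by positivity)
      · simp [amp, hp]
    simp only [this, Finset.sum_ite_mem, Finset.univ_inter, Finset.sum_const, nsmul_eq_mul]
    ring
  have h2 : ∑ p, W.amp w (true, Fin.last _, p) ^ 2 = 0 := by simp [amp]
  have h3 : ∑ p, W.amp w (false, Fin.last _, p) ^ 2 = w := by
    rw [Finset.sum_eq_single s] <;> simp +contextual [amp, Real.sq_sqrt hw.le]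
  rw [sum_arc, h2, h3]
  simp only [h1]
  rw [Fin.sum_univ_eq_sum_range (fun k => (k + 1 : ℝ) * (W.nodes k).card)]
  ring

/-- The energy of the flow: it uses one edge per layer, of resistance `1 / (k + 1)`. -/
lemma sum_flow_sq {w : ℝ} (hw : 0 < w) (v : V) :
    ∑ x, W.flow w v x ^ 2 = 1 / w + 2 * ∑ k ∈ Finset.range W.len, 1 / (k + 1 : ℝ) := by
  have h1 : ∀ b (k : Fin W.len), ∑ p, W.flow w v (b, k.castSucc, p) ^ 2
      = 1 / ((k : ℕ) + 1 : ℝ) := by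
    intro b k
    rw [Finset.sum_eq_single (W.label v k)]
    · simp only [flow, Fin.val_castSucc, k.isLt, if_true, div_pow]
      rw [Real.sq_sqrt (by positivity)]
      cases b <;> simp
    · intro p _ hp
      simp [flow, hp]
    · simp
  have h2 : ∑ p, W.flow w v (true, Fin.last _, p) ^ 2 = 0 := by simp [flow]
  have h3 : ∑ p, W.flow w v (false, Fin.last _, p) ^ 2 = 1 / w := by
    rw [Finset.sum_eq_single s] <;> simp +contextual [flow, div_pow, Real.sq_sqrt hw.le]
  rw [sum_arc, h2, h3]
  simp only [h1]
  rw [Fin.sum_univ_eq_sum_range (fun k => 1 / (k + 1 : ℝ))]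
  ring

/-- Kirchhoff's law: at a node on the walk the incoming and outgoing units cancel, at `s` because
the dangling arc carries the unit away. Only the source `(0, v)` is unbalanced. -/
lemma sum_amp_mul_flow {w : ℝ} (hw : 0 < w) (v : V) (u : ℕ × V) :
    ∑ x with W.node x = u, (W.amp w x : ℂ) * (W.flow w v x : ℂ) = if u = (0, v) then -1 else 0 := by
  have hprod : ∀ b (k : Fin W.len), ∑ p, (if W.node (b, k.castSucc, p) = u then
      W.amp w (b, k.castSucc, p) * W.flow w v (b, k.castSucc, p) else 0)
      = if W.node (b, k.castSucc, W.label v k) = u then (if b then 1 else -1) else 0 := by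
    intro b k
    rw [Finset.sum_eq_single (W.label v k)]
    · have hk : (0 : ℝ) < (k : ℕ) + 1 := by positivity
      have hmem : W.label v k ∈ W.nodes k := W.label_mem v k k.isLt.le
      simp only [amp, flow, Fin.val_castSucc, k.isLt, if_true, hmem]
      rw [mul_div_cancel₀ _ (Real.sqrt_pos.2 hk).ne']
    · intro p _ hp
      simp [flow, hp]
    · simp
  have h2 : ∑ p, (if W.node (true, Fin.last _, p) = u then
      W.amp w (true, Fin.last _, p) * W.flow w v (true, Fin.last _, p) else 0) = 0 := by
    simp [flow]
  have h3 : ∑ p, (if W.node (false, Fin.last _, p) = u then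
      W.amp w (false, Fin.last _, p) * W.flow w v (false, Fin.last _, p) else 0)
      = if (W.len, W.label v W.len) = u then -1 else 0 := by
    rw [Finset.sum_eq_single s]
    · simp only [amp, flow, Fin.val_last, lt_irrefl, if_false, and_self, if_true, node,
        Bool.false_eq_true, label_len]
      rw [mul_div_cancel₀ _ (Real.sqrt_pos.2 hw).ne']
    · intro p _ hp
      simp [flow, hp]
    · simp
  have hreal : ∑ x with W.node x = u, W.amp w x * W.flow w v x = if u = (0, v) then -1 else 0 := by
    rw [Finset.sum_filter, sum_arc, h2, h3]
    simp only [hprod]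
    simp only [node, Fin.val_castSucc, if_true, Bool.false_eq_true, if_false]
    rw [Fin.sum_univ_eq_sum_range
      (fun k => if (k + 1, W.next k (W.label v k)) = u then (1 : ℝ) else 0),
      Fin.sum_univ_eq_sum_range (fun k => if (k, W.label v k) = u then (-1 : ℝ) else 0),
      ← Finset.sum_range_succ (fun k => if (k, W.label v k) = u then (-1 : ℝ) else 0),
      Finset.sum_range_succ', add_zero, ← add_assoc, ← Finset.sum_add_distrib]
    rw [Finset.sum_eq_zero]
    · simp [label, eq_comm]
    · intro k _
      change (if (k + 1, W.label v (k + 1)) = u then (1 : ℝ) else 0) +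
        (if (k + 1, W.label v (k + 1)) = u then (-1 : ℝ) else 0) = 0
      split_ifs <;> simp
  have := congrArg (fun r : ℝ => (r : ℂ)) hreal
  push_cast at this
  rw [this]
  split_ifs <;> simp

theorem exists_quantumRobot_evaluates_or {T : ℕ} (hT : 2 ≤ T)
    (hcost : 3 * (1 + 8 * (∑ k ∈ Finset.range W.len, 1 / (k + 1 : ℝ)) *
      ∑ k ∈ Finset.range W.len, (k + 1 : ℝ) * (W.nodes k).card) ≤ (T : ℝ) ^ 2) :
    ∃ A : QuantumRobot G, A.Evaluates s orFunction (4 * T + 4) := by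
  set H : ℝ := ∑ k ∈ Finset.range W.len, 1 / (k + 1 : ℝ) with hH
  have hHpos : 0 < H :=
    Finset.sum_pos (fun k _ => by positivity) (by simpa using W.len_pos.ne')
  -- With this `w` the flow has squared norm `4 * H + 2 * H`, of which `4 * H` sits on the start
  -- arc: exactly the ratio `3 : 2` required.
  set w : ℝ := 1 / (4 * H) with hw
  have hwpos : 0 < w := by positivity
  have hstart : W.arcPos W.start = s := by
    simp [arcPos, start, node, W.pos_len]
  rw [← hstart]
  refine _root_.exists_quantumRobot_evaluates_or G W.arcPos W.start
    (fun x => decide (x.1 = false ∧ (x.2.1 : ℕ) = 0))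
    (starReflection_mem_unitaryGroup W.node (W.amp w))
    (signedPermutation_mem_unitaryGroup W.flip_flip W.flipSign_mul_self W.flipSign_flip)
    (isLocalAlong_of_loc_eq G _ fun x y h => starReflection_apply_of_ne _ _ fun h' =>
      h (by rw [arcPos, arcPos, h']))
    (signedPermutation_isLocalAlong W.flip_flip W.arcPos_flip) hT ?_ ?_
  -- `R` negates the amplitudes; `S` restores the sign in every layer but the last, so only the
  -- start arc contributes to `c - S R c`.
  · refine ⟨fun x => (W.amp w x : ℂ), √w, Real.sqrt_pos.2 hwpos, ?_, ?_⟩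
    · rw [← Matrix.mulVec_mulVec, starReflection_mulVec_self]
      ext ⟨b, k, p⟩
      rw [Pi.sub_apply, signedPermutation_mulVec]
      by_cases hk : (k : ℕ) < W.len
      · have : W.start ≠ (b, k, p) := by
          rintro h
          have : k = Fin.last _ := (congrArg (fun x => x.2.1) h).symm
          simp [this] at hk
        rw [Pi.single_eq_of_ne this.symm]
        simp [flipSign, flip, amp, hk]
      · have hk' : k = Fin.last _ := Fin.ext (by have := k.isLt; simp; omega)
        subst hk'
        by_cases hb : b = false ∧ p = s
        · obtain ⟨rfl, rfl⟩ := hb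
          rw [show ((false, Fin.last W.len, p) : W.Arc) = W.start from rfl, Pi.single_eq_same]
          simp [flipSign, flip, amp, start]
          ring
        · have : W.start ≠ (b, Fin.last _, p) := by
            rintro h
            exact hb ⟨(congrArg (fun x => x.1) h).symm, (congrArg (fun x => x.2.2) h).symm⟩
          rw [Pi.single_eq_of_ne this.symm]
          simp [flipSign, flip, amp, hb]
    · simp only [Complex.norm_real, Real.norm_eq_abs, sq_abs]
      rw [W.sum_amp_sq hwpos, Real.sq_sqrt hwpos.le]
      calc 3 * (w + 2 * ∑ k ∈ Finset.range W.len, (k + 1 : ℝ) * (W.nodes k).card)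
          = w * (3 * (1 + 8 * H * ∑ k ∈ Finset.range W.len, (k + 1 : ℝ) * (W.nodes k).card)) := by
            rw [hw]; field_simp; ring
        _ ≤ w * (T : ℝ) ^ 2 := by gcongr
  · intro X v hv
    -- The flow is antisymmetric under reversal, which the sign `-1` compensates; the start arc is
    -- left alone.
    have hS : ∀ x, (W.flipSign x : ℂ) * (W.flow w v (W.flip x) : ℂ) = W.flow w v x := by
      rintro ⟨b, k, p⟩
      by_cases hk : (k : ℕ) < W.len
      · by_cases hp : p = W.label v k
        · cases b <;> simp [flipSign, flip, flow, hk, hp, neg_div]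
        · simp [flipSign, flip, flow, hk, hp]
      · simp [flipSign, flip, hk]
    refine ⟨fun x => (W.flow w v x : ℂ), ?_, ?_, ?_⟩
    · have hQR : (phaseQuery W.arcPos (fun x => decide (x.1 = false ∧ (x.2.1 : ℕ) = 0)) X).mulVec
          ((starReflection W.node (W.amp w)).mulVec fun x => (W.flow w v x : ℂ))
          = fun x => (W.flow w v x : ℂ) := by
        ext x
        rw [phaseQuery_mulVec, starReflection_mulVec, W.sum_amp_mul_flow hwpos]
        obtain ⟨b, k, p⟩ := x
        by_cases hx : W.node (b, k, p) = (0, v)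
        · have hb : b = false := by
            cases b
            · rfl
            · simp [node] at hx
          subst hb
          simp only [node, Bool.false_eq_true, if_false, Prod.mk.injEq] at hx
          obtain ⟨hk, rfl⟩ := hx
          have hk' : k = 0 := Fin.ext hk
          subst hk'
          have hX : X (W.arcPos (false, 0, p)) = true := by
            simpa [arcPos, node, W.pos_zero] using hv
          -- A node of layer `0` has a single arc, of amplitude `1`. There `R` is the sign `-1`,
          -- which the phase query at the marked vertex undoes.
          have hsum : ∑ e with W.node e = W.node (false, 0, p), (W.amp w e : ℂ) ^ 2 = 1 := by
            rw [Finset.sum_eq_single (false, 0, p)]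
            · simp [amp, W.len_pos, W.nodes_zero]
            · rintro ⟨b', k', p'⟩ h1 h2
              exfalso
              apply h2
              have h3 := (Finset.mem_filter.1 h1).2
              cases b'
              · simp only [node, Bool.false_eq_true, if_false, Prod.mk.injEq] at h3
                rw [show k' = 0 from Fin.ext h3.1, h3.2]
              · simp [node] at h3
            · simp
          rw [hsum, hX]
          simp [node, flow, amp, W.len_pos, W.nodes_zero, label]
          norm_num
        · rw [if_neg hx, mul_zero, sub_zero]
          split_ifs with h
          · simp only [decide_eq_true_eq] at h
            obtain ⟨⟨rfl, hk⟩, -⟩ := h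
            have hk' : k = 0 := Fin.ext hk
            subst hk'
            have hp : p ≠ v := by
              rintro rfl
              exact hx (by simp [node])
            simp [flow, W.len_pos, label, hp]
          · rfl
      rw [hQR]
      ext x
      rw [signedPermutation_mulVec, hS]
    · have : √w ≠ 0 := (Real.sqrt_pos.2 hwpos).ne'
      simp [flow, start, this]
    · simp only [Complex.norm_real, Real.norm_eq_abs, sq_abs]
      rw [W.sum_flow_sq hwpos]
      have : W.flow w v W.start ^ 2 = 4 * H := by
        simp only [flow, start, Fin.val_last, lt_irrefl, if_false, and_self, if_true, div_pow]
        rw [Real.sq_sqrt hwpos.le, hw]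
        field_simp
      rw [this, ← hH, hw, one_div_one_div]
      linarith

end CoalescingWalk

/-! ### Nets and the construction of the walk -/

section Nets

variable {V : Type*} [Fintype V] {G : SimpleGraph V}

/-- A maximal separated set containing `s`: a vertex farther than `2 * r` from all its points could
be added. -/
lemma exists_net (G : SimpleGraph V) (s : V) (r : ℕ) :
    ∃ N : Finset V, s ∈ N ∧ (∀ p ∈ N, ∀ q ∈ N, p ≠ q → 2 * r < G.dist p q) ∧
      ∀ v, ∃ p ∈ N, G.dist v p ≤ 2 * r := by
  classical
  obtain ⟨N, hsN, hN⟩ := Finite.exists_le_maximal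
    (p := fun N : Finset V => ∀ p ∈ N, ∀ q ∈ N, p ≠ q → 2 * r < G.dist p q) (a := {s})
    (by simp +contextual)
  refine ⟨N, hsN (Finset.mem_singleton_self s), hN.prop, fun v => ?_⟩
  by_contra! hv
  have h1 : ∀ p ∈ insert v N, ∀ q ∈ insert v N, p ≠ q → 2 * r < G.dist p q := by
    intro p hp q hq hpq
    rcases Finset.mem_insert.1 hp with rfl | hp' <;> rcases Finset.mem_insert.1 hq with rfl | hq'
    · exact absurd rfl hpq
    · exact hv q hq'
    · rw [G.dist_comm]; exact hv p hp'
    · exact hN.prop p hp' q hq' hpq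
  have h2 : v ∈ N := hN.le_of_ge h1 (Finset.subset_insert v N) (Finset.mem_insert_self v N)
  simpa using hv v h2

omit [Fintype V] in
lemma mem_graphBall_iff (hG : G.Connected) {v w : V} {l : ℕ} :
    w ∈ graphBall G v l ↔ G.dist v w ≤ l := by
  rw [graphBall, Set.mem_ofPred_eq, ← (hG v w).coe_dist_eq_edist]
  exact Nat.cast_le

/-- The balls of radius `r` around the points of the net are disjoint. -/
lemma card_mul_le_of_separated (hG : G.Connected) {r : ℕ} {N : Finset V}
    (hN : ∀ p ∈ N, ∀ q ∈ N, p ≠ q → 2 * r < G.dist p q) {m : ℝ}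
    (hm : ∀ v, m ≤ ((graphBall G v r).ncard : ℝ)) : N.card * m ≤ Fintype.card V := by
  classical
  have hdisj : (N : Set V).PairwiseDisjoint fun v => (graphBall G v r).toFinset := by
    intro p hp q hq hpq
    rw [Function.onFun, Finset.disjoint_left]
    intro v hv hv'
    rw [Set.mem_toFinset, mem_graphBall_iff hG] at hv hv'
    have h1 := hN p hp q hq hpq
    have h2 := hG.dist_triangle (u := p) (v := v) (w := q)
    rw [G.dist_comm (u := v)] at h2
    omega
  have h1 := Finset.card_le_univ (N.biUnion fun v => (graphBall G v r).toFinset)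
  rw [Finset.card_biUnion hdisj] at h1
  calc (N.card : ℝ) * m = ∑ _v ∈ N, m := by simp
    _ ≤ ∑ v ∈ N, ((graphBall G v r).toFinset.card : ℝ) := by
        refine Finset.sum_le_sum fun v _ => (hm v).trans ?_
        rw [Set.ncard_eq_toFinset_card']
    _ ≤ Fintype.card V := by exact_mod_cast h1

omit [Fintype V] in
lemma exists_lazy_path (hG : G.Connected) (p q : V) :
    ∃ γ : ℕ → V, γ 0 = p ∧ (∀ i, G.dist p q ≤ i → γ i = q) ∧
      ∀ i, γ i = γ (i + 1) ∨ G.Adj (γ i) (γ (i + 1)) := by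
  obtain ⟨w, hw⟩ := hG.exists_walk_length_eq_dist p q
  refine ⟨w.getVert, w.getVert_zero, fun i hi => w.getVert_of_length_le (hw ▸ hi), fun i => ?_⟩
  by_cases hi : i < w.length
  · exact Or.inr (w.adj_getVert_succ hi)
  · left
    rw [w.getVert_of_length_le (by omega), w.getVert_of_length_le (by omega)]

end Nets

/-- During the times from `2 ^ j` to `2 ^ (j + 1)` each walk follows a geodesic from its point of
the `j`-th net to a nearby point of the next net, waiting there if it arrives early. Walks sharing a
net point move as one, and growth bounds the number of points. -/
lemma exists_coalescingWalk {V : Type*} [Fintype V] {G : SimpleGraph V} (hG : G.Connected)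
    (s : V) {κ : ℝ} (hκ : 0 < κ) (hκ1 : κ ≤ 1) (hn : 2 ≤ Fintype.card V)
    (hdim : ∀ (v : V) (l : ℕ),
      min (κ * (l : ℝ) ^ 2) (Fintype.card V : ℝ) ≤ ((graphBall G v l).ncard : ℝ)) :
    ∃ (W : CoalescingWalk G s) (J : ℕ), W.len = 2 ^ (J + 1) ∧
      κ * 4 ^ J < 16 * (Fintype.card V : ℝ) ∧ ∀ k < W.len,
        (W.nodes k).card * (κ * 4 ^ Nat.log 2 k) ≤ 16 * (Fintype.card V : ℝ) := by
  classical
  set n : ℝ := (Fintype.card V : ℝ) with hn_def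
  have hn2 : (2 : ℝ) ≤ n := by rw [hn_def]; exact_mod_cast hn
  have hex : ∃ j : ℕ, 16 * n ≤ κ * 4 ^ j := by
    obtain ⟨j, hj⟩ := pow_unbounded_of_one_lt (16 * n / κ) (by norm_num : (1 : ℝ) < 4)
    exact ⟨j, by rw [div_lt_iff₀ hκ] at hj; linarith⟩
  -- The least scale at which the growth hypothesis makes a ball of radius `2 ^ J₀ / 4` the whole
  -- graph, so that the net is `{s}`.
  obtain ⟨J₀, hJ₀, hmin⟩ : ∃ J, 16 * n ≤ κ * 4 ^ J ∧ ∀ j < J, κ * 4 ^ j < 16 * n :=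
    ⟨Nat.find hex, Nat.find_spec hex, fun j hj => not_le.1 (Nat.find_min hex hj)⟩
  have hJ2 : 2 ≤ J₀ := by
    by_contra! h
    have h1 : (4 : ℝ) ^ J₀ ≤ 4 ^ 1 := pow_le_pow_right₀ (by norm_num) (by omega)
    nlinarith
  have hradius : ∀ j, 2 ≤ j → ((2 ^ j / 4 : ℕ) : ℝ) ^ 2 = 4 ^ j / 16 := by
    intro j hj
    obtain ⟨i, rfl⟩ := Nat.exists_eq_add_of_le hj
    have : 2 ^ (2 + i) / 4 = 2 ^ i := by
      rw [pow_add]; exact Nat.mul_div_cancel_left _ (by norm_num)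
    rw [this, pow_add]
    push_cast
    rw [← pow_mul, mul_comm i 2, pow_mul]
    norm_num
  choose N hsN hNsep hNcov using fun j : ℕ => exists_net G s (2 ^ j / 4)
  choose par hpar hpardist using fun (j : ℕ) (p : V) => hNcov (j + 1) p
  choose γ hγ0 hγ1 hγadj using fun (j : ℕ) (p : V) => exists_lazy_path hG p (par j p)
  -- The next net covers within `2 * (2 ^ (j + 1) / 4) ≤ 2 ^ j`, the number of steps available.
  have hγend : ∀ j p, γ j p (2 ^ j) = par j p := by
    intro j p
    refine hγ1 j p _ ((hpardist j p).trans ?_)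
    rw [pow_succ]; omega
  have hlog : ∀ k, Nat.log 2 (k + 1) ≠ Nat.log 2 k →
      k + 1 = 2 ^ (Nat.log 2 k + 1) ∧ Nat.log 2 (k + 1) = Nat.log 2 k + 1 := by
    intro k hk
    have h1 : Nat.log 2 k < Nat.log 2 (k + 1) :=
      lt_of_le_of_ne (Nat.log_mono_right (Nat.le_succ k)) (Ne.symm hk)
    have h2 : k < 2 ^ (Nat.log 2 k + 1) := Nat.lt_pow_succ_log_self (by norm_num) k
    have h3 : 2 ^ Nat.log 2 (k + 1) ≤ k + 1 := Nat.pow_log_le_self 2 (by omega)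
    have h4 : 2 ^ (Nat.log 2 k + 1) ≤ 2 ^ Nat.log 2 (k + 1) :=
      Nat.pow_le_pow_right (by norm_num) h1
    have h5 : k + 1 = 2 ^ (Nat.log 2 k + 1) := by omega
    refine ⟨h5, ?_⟩
    conv_lhs => rw [h5]
    exact Nat.log_pow (by norm_num) _
  -- The integer quotient `2 ^ 0 / 4` is `0`, so the net at scale `0` covers within distance `0`.
  have hN0 : N 0 = Finset.univ := by
    ext v
    obtain ⟨p, hp, hvp⟩ := hNcov 0 v
    have : G.dist v p = 0 := by simpa using hvp
    rw [(hG v p).dist_eq_zero_iff] at this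
    simp [this, hp]
  have hNJ : N J₀ = {s} := by
    refine Finset.eq_singleton_iff_unique_mem.2 ⟨hsN J₀, fun p hp => ?_⟩
    by_contra hps
    have h1 := hNsep J₀ s (hsN J₀) p hp (Ne.symm hps)
    have h2 := hdim s (2 ^ J₀ / 4)
    rw [hradius J₀ hJ2, min_eq_right (by linarith)] at h2
    have h3 : (graphBall G s (2 ^ J₀ / 4)) = Set.univ := by
      refine Set.eq_of_subset_of_ncard_le (Set.subset_univ _) ?_ Set.finite_univ
      rw [Set.ncard_univ, Nat.card_eq_fintype_card]
      rw [hn_def] at h2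
      exact_mod_cast h2
    have h4 : p ∈ graphBall G s (2 ^ J₀ / 4) := by rw [h3]; trivial
    rw [mem_graphBall_iff hG] at h4
    omega
  have hlogJ : Nat.log 2 (2 ^ J₀) = J₀ := Nat.log_pow (by norm_num) _
  let W : CoalescingWalk G s :=
    { len := 2 ^ J₀
      len_pos := by positivity
      nodes := fun k => N (Nat.log 2 k)
      next := fun k p => if Nat.log 2 (k + 1) = Nat.log 2 k then p else par (Nat.log 2 k) p
      pos := fun k p => γ (Nat.log 2 k) p (k - 2 ^ Nat.log 2 k)
      nodes_zero := by simpa using hN0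
      nodes_len := by rw [hlogJ, hNJ]
      next_mem := by
        intro k _ p hp
        by_cases h : Nat.log 2 (k + 1) = Nat.log 2 k
        · simpa [h] using hp
        · rw [if_neg h, (hlog k h).2]
          exact hpar _ _
      pos_zero := by intro p; simp [hγ0]
      pos_len := by rw [hlogJ, Nat.sub_self, hγ0]
      adj := by
        intro k p
        by_cases h : Nat.log 2 (k + 1) = Nat.log 2 k
        · rw [if_pos h, h]
          -- Times `0` and `1` both have logarithm `0`, and truncated subtraction gives offset `0`
          -- at both: the walk waits for one step.
          rcases Nat.eq_zero_or_pos k with rfl | hk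
          · left; simp
          · have h1 : 2 ^ Nat.log 2 k ≤ k := Nat.pow_log_le_self 2 hk.ne'
            rw [Nat.sub_add_comm h1]
            exact hγadj _ _ _
        · obtain ⟨h1, h2⟩ := hlog k h
          rw [if_neg h, h2, ← h1, Nat.sub_self, hγ0, ← hγend]
          have h3 : 2 ^ Nat.log 2 k = k - 2 ^ Nat.log 2 k + 1 := by
            rw [pow_succ] at h1; omega
          nth_rewrite 2 [h3]
          nth_rewrite 4 [h3]
          exact hγadj _ _ _ }
  obtain ⟨J, rfl⟩ : ∃ J, J₀ = J + 1 := ⟨J₀ - 1, by omega⟩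
  refine ⟨W, J, rfl, hmin J (Nat.lt_succ_self J), fun k hk => ?_⟩
  change ((N (Nat.log 2 k)).card : ℝ) * _ ≤ _
  have hj : κ * 4 ^ Nat.log 2 k < 16 * n :=
    hmin _ (Nat.log_lt_of_lt_pow' (by omega) hk)
  set j := Nat.log 2 k
  by_cases h2 : 2 ≤ j
  · have := card_mul_le_of_separated hG (hNsep j) fun v => hdim v _
    rw [hradius j h2, min_eq_left (by linarith)] at this
    linarith
  -- For `j < 2` the radius is `0` and the trivial bound on the net suffices, since `κ ≤ 1`.
  · have h3 : ((N j).card : ℝ) ≤ n := by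
      rw [hn_def]; exact_mod_cast Finset.card_le_univ (N j)
    have h4 : (4 : ℝ) ^ j ≤ 4 ^ 1 := pow_le_pow_right₀ (by norm_num) (by omega)
    have h5 : κ * 4 ^ j ≤ 16 := by nlinarith [pow_pos (by norm_num : (0 : ℝ) < 4) j]
    calc ((N j).card : ℝ) * (κ * 4 ^ j) ≤ n * 16 := by gcongr
      _ = 16 * n := mul_comm _ _

/-! ### Cost under quadratic growth -/

/-- Layer `k` has at most `4 * B / (k + 1) ^ 2` nodes, because `k + 1 ≤ 2 * 2 ^ Nat.log 2 k`.
Conductance `k + 1` thus makes both conductance and energy harmonic sums. -/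
lemma CoalescingWalk.sum_mul_card_le {V : Type*} [Fintype V] {G : SimpleGraph V} {s : V}
    (W : CoalescingWalk G s) {B : ℝ}
    (hB : ∀ k < W.len, ((W.nodes k).card : ℝ) * 4 ^ Nat.log 2 k ≤ B) :
    ∑ k ∈ Finset.range W.len, (k + 1 : ℝ) * (W.nodes k).card
      ≤ 4 * B * ∑ k ∈ Finset.range W.len, 1 / (k + 1 : ℝ) := by
  rw [Finset.mul_sum]
  refine Finset.sum_le_sum fun k hk => ?_
  have h1 := hB k (Finset.mem_range.1 hk)
  have h2 : (k + 1 : ℝ) ≤ 2 * 2 ^ Nat.log 2 k := by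
    have : k < 2 ^ (Nat.log 2 k + 1) := Nat.lt_pow_succ_log_self (by norm_num) k
    rw [pow_succ'] at this
    exact_mod_cast this
  have h3 : (k + 1 : ℝ) ^ 2 ≤ 4 * 4 ^ Nat.log 2 k := by
    calc (k + 1 : ℝ) ^ 2 ≤ (2 * 2 ^ Nat.log 2 k) ^ 2 := by gcongr
      _ = 4 * 4 ^ Nat.log 2 k := by rw [mul_pow, ← pow_mul, mul_comm _ 2, pow_mul]; norm_num
  rw [mul_one_div, le_div_iff₀ (by positivity)]
  calc (k + 1 : ℝ) * (W.nodes k).card * (k + 1) = (W.nodes k).card * (k + 1 : ℝ) ^ 2 := by ring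
    _ ≤ (W.nodes k).card * (4 * 4 ^ Nat.log 2 k) := by gcongr
    _ ≤ 4 * B := by linarith

lemma sum_one_div_le_one_add_log (m : ℕ) :
    ∑ k ∈ Finset.range m, 1 / (k + 1 : ℝ) ≤ 1 + Real.log m := by
  have := harmonic_le_one_add_log m
  simpa [harmonic] using this

/-- On graphs whose balls grow at least quadratically, `OR` takes `O(√n log n)` steps. -/
theorem robotComplexity_or_le_of_quadratic_growth {κ : ℝ} (hκ : 0 < κ) :
    ∃ C : ℝ, 0 ≤ C ∧ ∀ {V : Type*} [Fintype V] [DecidableEq V] (G : SimpleGraph V),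
      G.Connected → (∀ (v : V) (l : ℕ),
        min (κ * (l : ℝ) ^ 2) (Fintype.card V : ℝ) ≤ ((graphBall G v l).ncard : ℝ)) →
      2 ≤ Fintype.card V → ∀ s : V, (robotComplexity G s orFunction : ℝ≥0∞) ≤
        ENNReal.ofReal (C * (√(Fintype.card V : ℝ) * Real.log (Fintype.card V : ℝ))) := by
  wlog hκ1 : κ ≤ 1 generalizing κ
  · obtain ⟨C, hC, h⟩ := this one_pos le_rfl
    refine ⟨C, hC, fun {V} _ _ G hG hdim => h G hG fun v l => le_trans ?_ (hdim v l)⟩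
    gcongr
    exact (not_le.1 hκ1).le
  have hlog2 : 0 < Real.log 2 := Real.log_pos (by norm_num)
  have hlogκ : 0 ≤ Real.log (64 / κ) := Real.log_nonneg (by
    rw [le_div_iff₀ hκ]; linarith)
  -- The first factor comes from the ceiling `T` and `4 * T + 4`; the second absorbs the constant in
  -- `H ≤ 1 + log (64 n / κ)` into `log n ≥ log 2`.
  refine ⟨168 / √κ * (1 + (1 + Real.log (64 / κ)) / Real.log 2), by positivity, ?_⟩
  intro V _ _ G hG hdim hn s
  obtain ⟨W, J, hlen, hJ, hcard⟩ := exists_coalescingWalk hG s hκ hκ1 hn hdim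
  set n : ℝ := (Fintype.card V : ℝ) with hn_def
  have hn2 : (2 : ℝ) ≤ n := by rw [hn_def]; exact_mod_cast hn
  have hlogn : Real.log 2 ≤ Real.log n := Real.log_le_log (by norm_num) hn2
  set H : ℝ := ∑ k ∈ Finset.range W.len, 1 / (k + 1 : ℝ) with hH
  have hH1 : 1 ≤ H := by
    have : 1 / ((0 : ℕ) + 1 : ℝ) ≤ H :=
      Finset.single_le_sum (f := fun k : ℕ => 1 / (k + 1 : ℝ)) (fun k _ => by positivity)
        (Finset.mem_range.2 W.len_pos)
    simpa using this
  have hHlog : H ≤ (1 + (1 + Real.log (64 / κ)) / Real.log 2) * Real.log n := by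
    have h1 : H ≤ 1 + Real.log (64 / κ * n) := by
      refine (sum_one_div_le_one_add_log _).trans ?_
      gcongr
      · exact_mod_cast W.len_pos
      · rw [hlen, div_mul_eq_mul_div, le_div_iff₀ hκ]
        push_cast
        calc (2 : ℝ) ^ (J + 1) * κ ≤ 4 ^ (J + 1) * κ := by gcongr; norm_num
          _ = 4 * (κ * 4 ^ J) := by ring
          _ ≤ 64 * n := by linarith
    rw [Real.log_mul (by positivity) (by positivity)] at h1
    have h2 : 1 + Real.log (64 / κ) ≤ (1 + Real.log (64 / κ)) / Real.log 2 * Real.log n := by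
      rw [div_mul_eq_mul_div, le_div_iff₀ hlog2]
      gcongr
    linarith
  have hnκ : 1 ≤ n / κ := by rw [le_div_iff₀ hκ]; linarith
  have hsq1 : 1 ≤ √(n / κ) := Real.one_le_sqrt.2 hnκ
  have hsum := W.sum_mul_card_le (B := 16 * n / κ) fun k hk => by
    rw [le_div_iff₀ hκ]
    linarith [hcard k hk]
  rw [← hH] at hsum
  have hmul : 1 ≤ √(n / κ) * H := one_le_mul_of_one_le_of_one_le hsq1 hH1
  -- The choice `40 ^ 2 = 1600` leaves room above `1536 = 3 * 8 * 64` for the additive `3`, as `√(n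
  -- / κ) * H ≥ 1`.
  set T : ℕ := ⌈40 * (√(n / κ) * H)⌉₊ with hT
  have hT1 : 40 * (√(n / κ) * H) ≤ T := Nat.le_ceil _
  have hT2 : (T : ℝ) < 40 * (√(n / κ) * H) + 1 := Nat.ceil_lt_add_one (by positivity)
  have hTle : 2 ≤ T := by
    have : (2 : ℝ) ≤ T := by linarith
    exact_mod_cast this
  obtain ⟨A, hA⟩ := W.exists_quantumRobot_evaluates_or hTle (by
    rw [← hH]
    have hsq : (√(n / κ) * H) ^ 2 = n / κ * H ^ 2 := by
      rw [mul_pow, Real.sq_sqrt (by positivity)]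
    calc 3 * (1 + 8 * H * ∑ k ∈ Finset.range W.len, (k + 1 : ℝ) * (W.nodes k).card)
        ≤ 3 * (1 + 8 * H * (4 * (16 * n / κ) * H)) := by gcongr
      _ = 3 + 1536 * (√(n / κ) * H) ^ 2 := by rw [hsq]; ring
      _ ≤ (40 * (√(n / κ) * H)) ^ 2 := by nlinarith
      _ ≤ (T : ℝ) ^ 2 := by gcongr)
  have hle : robotComplexity G s orFunction ≤ ((4 * T + 4 : ℕ) : ℕ∞) :=
    iInf₂_le (4 * T + 4) ⟨A, hA⟩
  calc (robotComplexity G s orFunction : ℝ≥0∞) ≤ ((4 * T + 4 : ℕ) : ℝ≥0∞) := by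
        exact_mod_cast hle
    _ = ENNReal.ofReal ((4 * T + 4 : ℕ) : ℝ) := (ENNReal.ofReal_natCast _).symm
    _ ≤ _ := by
        refine ENNReal.ofReal_le_ofReal ?_
        push_cast
        calc (4 * T + 4 : ℝ) ≤ 168 * (√(n / κ) * H) := by linarith
          _ ≤ 168 * (√(n / κ) *
              ((1 + (1 + Real.log (64 / κ)) / Real.log 2) * Real.log n)) := by gcongr
          _ = _ := by rw [Real.sqrt_div' _ hκ.le]; ring

/-! ### The two cases of the theorem -/

lemma exists_mul_sq_le_two_rpow {C : ℝ} (hC : 0 ≤ C) :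
    ∃ D : ℝ, ∀ x : ℝ, 0 ≤ x → C * x ^ 2 ≤ (2 : ℝ) ^ (D * x) := by
  have hlog2 : 0 < Real.log 2 := Real.log_pos (by norm_num)
  -- With `y = (2 * C + 2) * x`, the term `y ^ 2 / 2` of the exponential series already dominates `C
  -- * x ^ 2`.
  refine ⟨(2 * C + 2) / Real.log 2, fun x hx => ?_⟩
  rw [Real.rpow_def_of_pos (by norm_num)]
  have h1 : Real.log 2 * ((2 * C + 2) / Real.log 2 * x) = (2 * C + 2) * x := by field_simp
  rw [h1]
  have h2 := Real.quadratic_le_exp_of_nonneg (x := (2 * C + 2) * x) (by positivity)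
  have h3 : 0 ≤ (2 * C + 2) * x := by positivity
  nlinarith [sq_nonneg x, mul_nonneg hC (sq_nonneg x), mul_nonneg (mul_nonneg hC hC) (sq_nonneg x)]

theorem mainTheorem6 {ι : Type*} {V : ι → Type*} [∀ i, Fintype (V i)] [∀ i, DecidableEq (V i)]
    (G : ∀ i, SimpleGraph (V i)) :
    (∀ d : ℝ, 2 < d → IsDimensionalFamily G d →
      ∃ (C : ℝ) (k : ℕ), ∀ i, 2 ≤ Fintype.card (V i) → ∀ s : V i,
        (robotComplexity (G i) s orFunction : ℝ≥0∞) ≤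
          ENNReal.ofReal (C * (√(Fintype.card (V i) : ℝ) *
            Real.log (Fintype.card (V i) : ℝ) ^ k))) ∧
    (IsDimensionalFamily G 2 →
      ∃ C : ℝ, ∀ i, 2 ≤ Fintype.card (V i) → ∀ s : V i,
        (robotComplexity (G i) s orFunction : ℝ≥0∞) ≤
          ENNReal.ofReal (√(Fintype.card (V i) : ℝ) *
            (2 : ℝ) ^ (C * √(Real.log (Fintype.card (V i) : ℝ))))) := by

  constructor
  · rintro d hd ⟨hconn, κ, hκ, hdim⟩
    obtain ⟨C, -, hC⟩ := robotComplexity_or_le_of_quadratic_growth hκ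
    refine ⟨C, 1, fun i hi s => ?_⟩
    rw [pow_one]
    refine hC (G i) (hconn i) (fun v l => le_trans ?_ (hdim i v l)) hi s
    gcongr
    -- For `l ≥ 1` the power `l ^ d` with `d > 2` dominates `l ^ 2`, so quadratic growth holds with
    -- the same `κ`.
    rcases Nat.eq_zero_or_pos l with rfl | hl
    · simp only [Nat.cast_zero]
      rw [zero_pow two_ne_zero]
      positivity
    · rw [← Real.rpow_natCast]
      exact Real.rpow_le_rpow_of_exponent_le (by exact_mod_cast hl) (by exact_mod_cast hd.le)
  · rintro ⟨hconn, κ, hκ, hdim⟩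
    obtain ⟨C, hC0, hC⟩ := robotComplexity_or_le_of_quadratic_growth hκ
    obtain ⟨D, hD⟩ := exists_mul_sq_le_two_rpow hC0
    refine ⟨D, fun i hi s => ?_⟩
    refine (hC (G i) (hconn i) (fun v l => ?_) hi s).trans (ENNReal.ofReal_le_ofReal ?_)
    · simpa only [Real.rpow_two] using hdim i v l
    · have hlog : 0 ≤ Real.log (Fintype.card (V i) : ℝ) :=
        Real.log_nonneg (by exact_mod_cast (by omega : 1 ≤ Fintype.card (V i)))
      -- Taking `x = √(log n)` turns `C * log n` into `C * x ^ 2`, which is at most `2 ^ (D * x)`.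
      have := hD _ (Real.sqrt_nonneg (Real.log (Fintype.card (V i) : ℝ)))
      rw [Real.sq_sqrt hlog] at this
      calc C * (√(Fintype.card (V i) : ℝ) * Real.log (Fintype.card (V i) : ℝ))
          = √(Fintype.card (V i) : ℝ) * (C * Real.log (Fintype.card (V i) : ℝ)) := by ring
        _ ≤ _ := by gcongr
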